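/- Let $d\ge 1$ and let $f$ be a probability density on $\mathbb R^d$ (with Euclidean norm $\|\cdot\|$) that is twice differentiable and satisfies, for constants $C_b,C_c$ and all $x$, (a) $f(x)\le 1$; (b) $\|\nabla f(x)\|\le C_b f(x)\left(1+\ln\frac1{f(x)}\right)$; (c) $\|\nabla^2 f(x)\|_{op}\le C_c f(x)\left(1+\ln\frac1{f(x)}\right)$ (the right-hand sides being read as $0$ where $f(x)=0$). Suppose moreover that there are $\gamma>0$, $r_0>0$ and $\mathcal N_0$ such that for all $m>0$ and all $0<r\le r_0$ the set $\{x: f(x)>m\}$ can be covered by at most $\mathcal N_0/(m^\gamma r^d)$ balls of radius $r$. Let $X_1,\dots,X_N$ be i.i.d. with density $f$, let $2\le k\le N$, let $\rho(x)$ be the distance from $x$ to its $k$-th nearest neighbour among $X_1,\dots,X_N$, and let $$\hat f(x)=\frac{k-1}{N\,V(B(x,\rho(x)))}$$ be the kNN density estimator, where $V(B(x,\rho))$ is the volume of the ball of centre $x$ and radius $\rho$. Then for every $A>0$ there is a constant $C$, depending only on $d,C_b,C_c,\mathcal N_0,\gamma,r_0$ and $A$, such that for all $2\le k\le N$ and all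 $\epsilon\in(0,1)$ with $\ln\frac N\epsilon\le A k$, with probability at least $1-\epsilon$, $$\sup_{x\in\mathbb R^d}|\hat f(x)-f(x)|\le C\left(\left(\frac kN\right)^{2/d}+k^{-1/2}\sqrt{\ln\frac N\epsilon}\right)\quad\text{if } d>2,$$ $$\sup_{x\in\mathbb R^d}|\hat f(x)-f(x)|\le C\left(\frac kN\ln^d N+k^{-1/2}\sqrt{\ln\frac N\epsilon}\right)\quad\text{if } d=1,2.$$ -/

import Mathlib

open MeasureTheory ProbabilityTheory
open scoped NNReal ENNReal

noncomputable section

namespace KNN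

/-- The distance `ρ(x)` from `x` to its `k`-th nearest neighbour among the sample points
`X 0, …, X (N-1)`: the least radius `r` such that at least `k` of the sample points are within
distance `r` of `x` (used for `1 ≤ k ≤ N`). -/
def kthDist {d N : ℕ} (k : ℕ) (X : Fin N → EuclideanSpace ℝ (Fin d))
    (x : EuclideanSpace ℝ (Fin d)) : ℝ :=
  sInf {r : ℝ | k ≤ Nat.card {i : Fin N // dist x (X i) ≤ r}}

/-- The kNN density estimator `(k - 1) / (N V(B(x, ρ(x))))`. If `ρ(x) = 0` the value is the
conventional one of a division by zero; for `k ≥ 2` and samples from a density this requires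
two coinciding sample points, an event of probability zero. -/
def estimator {d N : ℕ} (k : ℕ) (X : Fin N → EuclideanSpace ℝ (Fin d))
    (x : EuclideanSpace ℝ (Fin d)) : ℝ :=
  ((k : ℝ) - 1) / (N * volume.real (Metric.ball x (kthDist k X x)))

/-- The uniform error `sup_x |f̂(x) - f(x)|`, as an extended nonnegative real. -/
def supError {d N : ℕ} (k : ℕ) (X : Fin N → EuclideanSpace ℝ (Fin d))
    (f : EuclideanSpace ℝ (Fin d) → ℝ) : ℝ≥0∞ :=
  ⨆ x, ENNReal.ofReal |estimator k X x - f x|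

/-- The smoothness assumptions on a density: it is nonnegative, twice differentiable, bounded by
one, and its gradient and Hessian (in operator norm) are bounded by `f (1 + ln (1 / f))` up to
the constants `Cb` and `Cc`. The gradient is represented by the derivative `fderiv ℝ f x` and the
Hessian by `fderiv ℝ (fderiv ℝ f) x`, which have the same norms. Where `f x = 0` the right-hand
sides are zero. -/
structure SmoothTail {d : ℕ} (Cb Cc : ℝ) (f : EuclideanSpace ℝ (Fin d) → ℝ) : Prop where
  nonneg : ∀ x, 0 ≤ f x
  differentiable : Differentiable ℝ f
  differentiable_fderiv : Differentiable ℝ (fderiv ℝ f)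
  le_one : ∀ x, f x ≤ 1
  gradient_le : ∀ x, ‖fderiv ℝ f x‖ ≤ Cb * (f x * (1 + Real.log (1 / f x)))
  hessian_le : ∀ x, ‖fderiv ℝ (fderiv ℝ f) x‖ ≤ Cc * (f x * (1 + Real.log (1 / f x)))

/-- The covering number assumption on the super-level sets: for every level `m > 0` and every
radius `0 < r ≤ r₀`, the set `{x | f x > m}` is covered by at most `N₀ / (m ^ γ * r ^ d)` balls of
radius `r`. (For `r → ∞` the bound tends to zero, while a nonempty set needs at least one ball, so
that the radius has to be bounded.) -/
def LevelSetCovering {d : ℕ} (N₀ γ r₀ : ℝ) (f : EuclideanSpace ℝ (Fin d) → ℝ) : Prop :=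
  ∀ m : ℝ, 0 < m → ∀ r : ℝ≥0, 0 < r → (r : ℝ) ≤ r₀ →
    (Metric.externalCoveringNumber r {x | m < f x} : ℝ≥0∞) ≤
      ENNReal.ofReal (N₀ / (m ^ γ * (r : ℝ) ^ d))

/-- The convergence rate. -/
def rate (d N k : ℕ) (ε : ℝ) : ℝ :=
  if 2 < d then
    ((k : ℝ) / N) ^ ((2 : ℝ) / d) + (k : ℝ) ^ (-(1 / 2) : ℝ) * √(Real.log (N / ε))
  else
    (k : ℝ) / N * Real.log N ^ d + (k : ℝ) ^ (-(1 / 2) : ℝ) * √(Real.log (N / ε))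

end KNN

end

namespace KNN

/-! ### Local control of the density from its gradient and Hessian bounds -/

section

/-! The gradient bound says that `log (1 - log f)` is `Cb`-Lipschitz. Hence `f` is positive
everywhere (`SmoothTail.pos`), and near a point with `f x ≤ t` it stays below `e * t` at distances
up to order `1 / (1 - log t)` (`SmoothTail.le_exp_one_mul`). At this scale the Hessian bound makes
the mean of `f` over a ball of radius `r` differ from `f x` by `O(f x * (1 - log (f x)) * r ^ 2)`,
the linear term cancelling by symmetry (`SmoothTail.abs_setIntegral_sub_le`).

Space is split at a density level `t = M * biasRate`. Let `R` solve `v * R ^ d * f z = k / N`, with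
`v` the volume of the unit ball. Where `f > t`, `R * (1 - log f)` is small. Chernoff bounds at the
points of a polynomially fine net, whose size the covering assumption controls, then place `ρ`
within a relative error `θ = η + O(R ^ 2 * (1 - log f))` of `R`, with `η` of order `√(log (N / ε) /
k)`. After multiplication by `f` the bias is `O(t)` (`measure_exists_lt_abs_sub_le`,
`GoodThreshold`).

Where `f ≤ t`, only `f̂ = O(t)` is needed, but this set is not covered by any finite net. Instead, a
ball with `k` sample points contains some `X i`, and the ball of twice the radius about `X i`
contains `k - 1` others. A union bound over the `N` sample points therefore suffices
(`measure_leave_one_out_le`, `measure_exists_card_ge_le`), and `log (N / ε) ≤ A * k` makes each term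
small. The same argument with the level `1` bounds `f̂` everywhere, which settles the case where the
rate is not small. -/

lemma mul_one_sub_log_le {a b : ℝ} (ha : 0 ≤ a) (hab : a ≤ b) (hb : b ≤ 1) :
    a * (1 + Real.log (1 / a)) ≤ b * (1 - Real.log b) := by
  rcases ha.eq_or_lt with rfl | ha
  · have := Real.log_nonpos hab hb
    rw [zero_mul]
    exact mul_nonneg hab (by linarith)
  · have hb' : 0 < b := ha.trans_le hab
    have h1 := Real.log_le_sub_one_of_pos (div_pos hb' ha)
    rw [Real.log_div hb'.ne' ha.ne'] at h1
    have h2 : a * (b / a) = b := by field_simp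
    have h3 := Real.log_nonpos hb'.le hb
    rw [one_div, Real.log_inv]
    nlinarith [mul_le_mul_of_nonneg_left h1 ha.le, mul_nonneg (sub_nonneg.2 hab) (neg_nonneg.2 h3)]

variable {d : ℕ} {Cb Cc : ℝ} {f : EuclideanSpace ℝ (Fin d) → ℝ}

lemma SmoothTail.weight_nonneg (hf : SmoothTail Cb Cc f) (x : EuclideanSpace ℝ (Fin d)) :
    0 ≤ f x * (1 + Real.log (1 / f x)) := by
  have := Real.log_nonpos (hf.nonneg x) (hf.le_one x)
  refine mul_nonneg (hf.nonneg x) ?_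
  rw [one_div, Real.log_inv]
  linarith

lemma SmoothTail.mono {Cb' Cc' : ℝ} (hf : SmoothTail Cb Cc f) (hb : Cb ≤ Cb') (hc : Cc ≤ Cc') :
    SmoothTail Cb' Cc' f where
  nonneg := hf.nonneg
  differentiable := hf.differentiable
  differentiable_fderiv := hf.differentiable_fderiv
  le_one := hf.le_one
  gradient_le x := (hf.gradient_le x).trans
    (mul_le_mul_of_nonneg_right hb (hf.weight_nonneg x))
  hessian_le x := (hf.hessian_le x).trans
    (mul_le_mul_of_nonneg_right hc (hf.weight_nonneg x))

/-- The gradient of `log (1 - log g)` has norm at most `C`, so the mean value inequality applies. A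
general `g` is allowed because positivity of the density is proved through a perturbation of it. -/
lemma one_sub_log_le_of_norm_fderiv_le {E : Type*} [NormedAddCommGroup E] [NormedSpace ℝ E]
    {g : E → ℝ} {C : ℝ} (hg : Differentiable ℝ g) (hpos : ∀ x, 0 < g x) (hle : ∀ x, g x ≤ 1)
    (hgrad : ∀ x, ‖fderiv ℝ g x‖ ≤ C * (g x * (1 - Real.log (g x)))) (x y : E) :
    1 - Real.log (g y) ≤ (1 - Real.log (g x)) * Real.exp (C * dist x y) := by
  have hlog : ∀ x, 0 < 1 - Real.log (g x) := fun x => by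
    have := Real.log_nonpos (hpos x).le (hle x)
    linarith
  have hder : ∀ x, HasFDerivAt (fun x => Real.log (1 - Real.log (g x)))
      ((1 - Real.log (g x))⁻¹ • (-((g x)⁻¹ • fderiv ℝ g x))) x := fun x => by
    have h1 := ((hg x).hasFDerivAt.log (hpos x).ne').const_sub 1
    exact h1.log (hlog x).ne'
  have hnorm : ∀ x, ‖(1 - Real.log (g x))⁻¹ • (-((g x)⁻¹ • fderiv ℝ g x))‖ ≤ C := fun x => by
    rw [norm_smul, norm_neg, norm_smul, norm_inv, norm_inv, Real.norm_of_nonneg (hlog x).le,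
      Real.norm_of_nonneg (hpos x).le, ← mul_assoc, ← mul_inv, inv_mul_le_iff₀
      (mul_pos (hlog x) (hpos x))]
    exact (hgrad x).trans_eq (by ring)
  have h := convex_univ.norm_image_sub_le_of_norm_hasFDerivWithin_le
    (fun x _ => (hder x).hasFDerivWithinAt) (fun x _ => hnorm x) (Set.mem_univ x) (Set.mem_univ y)
  have h2 := (le_abs_self _).trans h
  rw [← dist_eq_norm, dist_comm y x] at h2
  calc 1 - Real.log (g y) = Real.exp (Real.log (1 - Real.log (g y))) :=
        (Real.exp_log (hlog y)).symm
    _ ≤ Real.exp (Real.log (1 - Real.log (g x)) + C * dist x y) :=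
        Real.exp_le_exp.2 (by linarith)
    _ = _ := by rw [Real.exp_add, Real.exp_log (hlog x)]

/-- The perturbation `f * (1 - δ) + δ` is positive and obeys the same gradient bound, since `a * (1
- log a)` increases on `[0, 1]`. With `δ = exp (-B)`, a zero of `f` at `y` would give `1 + B ≤ B`.
-/
lemma SmoothTail.pos (hf : SmoothTail Cb Cc f) (hCb : 0 ≤ Cb) {x : EuclideanSpace ℝ (Fin d)}
    (hx : 0 < f x) (y : EuclideanSpace ℝ (Fin d)) : 0 < f y := by
  by_contra hy
  have hy0 : f y = 0 := le_antisymm (not_lt.1 hy) (hf.nonneg y)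
  set B := (1 - Real.log (f x)) * Real.exp (Cb * dist x y) with hB
  have hlogx := Real.log_nonpos hx.le (hf.le_one x)
  have hBpos : 0 ≤ B := mul_nonneg (by linarith) (Real.exp_pos _).le
  set δ := Real.exp (-B) with hδ
  have hδ0 : 0 < δ := Real.exp_pos _
  have hδ1 : δ ≤ 1 := Real.exp_le_one_iff.2 (by linarith)
  have hge : ∀ z, f z ≤ f z * (1 - δ) + δ := fun z => by nlinarith [hf.le_one z]
  have hle : ∀ z, f z * (1 - δ) + δ ≤ 1 := fun z => by nlinarith [hf.le_one z]
  have hpos : ∀ z, 0 < f z * (1 - δ) + δ := fun z => by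
    nlinarith [mul_nonneg (hf.nonneg z) (sub_nonneg.2 hδ1)]
  have key := one_sub_log_le_of_norm_fderiv_le (g := fun z => f z * (1 - δ) + δ) (C := Cb)
    ((hf.differentiable.mul_const _).add_const _) hpos hle (fun z => ?_) x y
  · rw [hy0, zero_mul, zero_add, hδ, Real.log_exp, ← hδ] at key
    have h1 : Real.log (f x) ≤ Real.log (f x * (1 - δ) + δ) := Real.log_le_log hx (hge x)
    have h2 : (1 - Real.log (f x * (1 - δ) + δ)) * Real.exp (Cb * dist x y) ≤ B :=
      mul_le_mul_of_nonneg_right (by linarith) (Real.exp_pos _).le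
    linarith
  · rw [fderiv_add_const, fderiv_mul_const (hf.differentiable z), norm_smul,
      Real.norm_of_nonneg (sub_nonneg.2 hδ1)]
    calc (1 - δ) * ‖fderiv ℝ f z‖ ≤ 1 * ‖fderiv ℝ f z‖ :=
          mul_le_mul_of_nonneg_right (by linarith) (norm_nonneg _)
      _ ≤ Cb * (f z * (1 + Real.log (1 / f z))) := by rw [one_mul]; exact hf.gradient_le z
      _ ≤ _ := mul_le_mul_of_nonneg_left (mul_one_sub_log_le (hf.nonneg z) (hge z) (hle z)) hCb

lemma SmoothTail.one_sub_log_le (hf : SmoothTail Cb Cc f) (hpos : ∀ x, 0 < f x)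
    (x y : EuclideanSpace ℝ (Fin d)) :
    1 - Real.log (f y) ≤ (1 - Real.log (f x)) * Real.exp (Cb * dist x y) := by
  refine one_sub_log_le_of_norm_fderiv_le hf.differentiable hpos hf.le_one (fun z => ?_) x y
  refine (hf.gradient_le z).trans_eq ?_
  rw [one_div, Real.log_inv, ← sub_eq_add_neg]

/-- With `a = Cb * dist y x`, the Lipschitz bound and `exp (-a) ≥ 1 - a` give `log (f y) ≤ log t + a
* (1 - log t)`, and the last term is at most `1`. -/
lemma SmoothTail.le_exp_one_mul (hf : SmoothTail Cb Cc f) (hpos : ∀ x, 0 < f x) (hCb : 0 ≤ Cb)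
    {t : ℝ} (ht0 : 0 < t) (ht1 : t ≤ 1) {x y : EuclideanSpace ℝ (Fin d)} (hx : f x ≤ t)
    (hxy : Cb * dist x y * (1 - Real.log t) ≤ 1) : f y ≤ Real.exp 1 * t := by
  have h1 := hf.one_sub_log_le hpos y x
  have h2 : Real.log (f x) ≤ Real.log t := Real.log_le_log (hpos x) hx
  have h3 := Real.log_nonpos ht0.le ht1
  set a := Cb * dist y x with ha
  have ha0 : 0 ≤ a := mul_nonneg hCb dist_nonneg
  rw [dist_comm x y, ← ha] at hxy
  have h4 : 1 - Real.log t ≤ (1 - Real.log (f y)) * Real.exp a := by linarith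
  have h5 : (1 - Real.log t) * Real.exp (-a) ≤ 1 - Real.log (f y) := by
    rw [Real.exp_neg]
    exact (div_le_iff₀ (Real.exp_pos a)).2 h4
  have h6 : 1 - a ≤ Real.exp (-a) := by linarith [Real.add_one_le_exp (-a)]
  have h7 : (1 - Real.log t) * (1 - a) ≤ 1 - Real.log (f y) :=
    (mul_le_mul_of_nonneg_left h6 (by linarith)).trans h5
  have h8 : Real.log (f y) ≤ 1 + Real.log t := by nlinarith
  calc f y = Real.exp (Real.log (f y)) := (Real.exp_log (hpos y)).symm
    _ ≤ Real.exp (1 + Real.log t) := Real.exp_le_exp.2 h8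
    _ = _ := by rw [Real.exp_add, Real.exp_log ht0]

lemma SmoothTail.abs_sub_le (hf : SmoothTail Cb Cc f) (hCb : 0 ≤ Cb)
    (x y : EuclideanSpace ℝ (Fin d)) : |f y - f x| ≤ Cb * dist x y := by
  have h := convex_univ.norm_image_sub_le_of_norm_fderiv_le (𝕜 := ℝ) (f := f) (C := Cb)
    (fun z _ => hf.differentiable z) (fun z _ => ?_) (Set.mem_univ x) (Set.mem_univ y)
  · rwa [← dist_eq_norm y x, dist_comm] at h
  · refine (hf.gradient_le z).trans ?_
    have := mul_one_sub_log_le (hf.nonneg z) (hf.le_one z) le_rfl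
    rw [Real.log_one] at this
    nlinarith

/-- On the ball both `f` and `1 - log f` exceed their values at `x` by a factor at most `e`, whence
`exp 2` in the Hessian bound. Two mean value inequalities then give the remainder, without the
factor `1 / 2`. -/
lemma SmoothTail.taylor (hf : SmoothTail Cb Cc f) (hpos : ∀ x, 0 < f x) (hCb : 0 ≤ Cb)
    (hCc : 0 ≤ Cc) {x : EuclideanSpace ℝ (Fin d)} {r : ℝ}
    (hr1 : Cb * r * (1 - Real.log (f x)) ≤ 1) {y : EuclideanSpace ℝ (Fin d)}
    (hy : y ∈ Metric.closedBall x r) :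
    |f y - f x - fderiv ℝ f x (y - x)|
      ≤ Cc * Real.exp 2 * (f x * (1 - Real.log (f x))) * r ^ 2 := by
  have hr : 0 ≤ r := dist_nonneg.trans hy
  have hlog : ∀ x, 0 ≤ - Real.log (f x) := fun x =>
    neg_nonneg.2 (Real.log_nonpos (hpos x).le (hf.le_one x))
  set H := Cc * Real.exp 2 * (f x * (1 - Real.log (f x))) with hH
  have hx0 := hlog x
  have hCbr : Cb * r ≤ 1 := by nlinarith [mul_nonneg hCb hr]
  have hess : ∀ z ∈ Metric.closedBall x r, ‖fderiv ℝ (fderiv ℝ f) z‖ ≤ H := by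
    intro z hz
    have hd : dist x z ≤ r := by rwa [dist_comm]
    have hCd : Cb * dist x z ≤ Cb * r := mul_le_mul_of_nonneg_left hd hCb
    have h1 : f z ≤ Real.exp 1 * f x :=
      hf.le_exp_one_mul hpos hCb (hpos x) (hf.le_one x) le_rfl
        ((mul_le_mul_of_nonneg_right hCd (by linarith)).trans hr1)
    have h2 : 1 - Real.log (f z) ≤ (1 - Real.log (f x)) * Real.exp 1 :=
      (hf.one_sub_log_le hpos x z).trans (mul_le_mul_of_nonneg_left
        (Real.exp_le_exp.2 (hCd.trans hCbr)) (by linarith))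
    refine (hf.hessian_le z).trans ?_
    rw [hH, mul_assoc]
    refine mul_le_mul_of_nonneg_left ?_ hCc
    rw [one_div, Real.log_inv, ← sub_eq_add_neg]
    calc f z * (1 - Real.log (f z))
        ≤ (Real.exp 1 * f x) * ((1 - Real.log (f x)) * Real.exp 1) :=
          mul_le_mul h1 h2 (by linarith [hlog z]) (mul_nonneg (Real.exp_pos _).le (hpos x).le)
      _ = _ := by
        rw [show (2 : ℝ) = 1 + 1 by norm_num, Real.exp_add]; ring
  have hxm : x ∈ Metric.closedBall x r := Metric.mem_closedBall_self hr
  have hH0 : 0 ≤ H := le_trans (by positivity) (hess x hxm)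
  have grad : ∀ z ∈ Metric.closedBall x r, ‖fderiv ℝ f z - fderiv ℝ f x‖ ≤ H * r := by
    intro z hz
    refine ((convex_closedBall x r).norm_image_sub_le_of_norm_fderiv_le (𝕜 := ℝ)
      (fun w _ => hf.differentiable_fderiv w) hess hxm hz).trans ?_
    rw [← dist_eq_norm]
    exact mul_le_mul_of_nonneg_left hz hH0
  have h := (convex_closedBall x r).norm_image_sub_le_of_norm_fderiv_le' (𝕜 := ℝ)
      (fun w _ => hf.differentiable w) grad hxm hy
  rw [Real.norm_eq_abs, ← dist_eq_norm y x] at h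
  refine h.trans ?_
  rw [sq, ← mul_assoc]
  exact mul_le_mul_of_nonneg_left hy (mul_nonneg hH0 hr)

lemma setIntegral_closedBall_clm_sub (φ : EuclideanSpace ℝ (Fin d) →L[ℝ] ℝ)
    (x : EuclideanSpace ℝ (Fin d)) (r : ℝ) :
    ∫ y in Metric.closedBall x r, φ (y - x) = 0 := by
  have h1 : ∫ y in Metric.closedBall x r, φ (y - x)
      = ∫ y, (Metric.closedBall (0 : EuclideanSpace ℝ (Fin d)) r).indicator φ (y - x) := by
    rw [← integral_indicator Metric.isClosed_closedBall.measurableSet]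
    congr 1
    ext y
    simp [Set.indicator, dist_eq_norm]
  rw [h1, integral_sub_right_eq_self
    (fun y => (Metric.closedBall (0 : EuclideanSpace ℝ (Fin d)) r).indicator φ y)]
  have h2 := integral_neg_eq_self
    (fun y => (Metric.closedBall (0 : EuclideanSpace ℝ (Fin d)) r).indicator φ y) volume
  have h3 : (fun y => (Metric.closedBall (0 : EuclideanSpace ℝ (Fin d)) r).indicator φ (-y))
      = fun y => -(Metric.closedBall (0 : EuclideanSpace ℝ (Fin d)) r).indicator φ y := by
    ext y
    simp only [Set.indicator, mem_closedBall_zero_iff, norm_neg, map_neg]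
    split_ifs <;> simp
  rw [h3, integral_neg] at h2
  linarith

lemma SmoothTail.abs_setIntegral_sub_le (hf : SmoothTail Cb Cc f) (hpos : ∀ x, 0 < f x)
    (hCb : 0 ≤ Cb) (hCc : 0 ≤ Cc) {x : EuclideanSpace ℝ (Fin d)} {r : ℝ}
    (hr1 : Cb * r * (1 - Real.log (f x)) ≤ 1) :
    |(∫ y in Metric.closedBall x r, f y) - f x * volume.real (Metric.closedBall x r)|
      ≤ Cc * Real.exp 2 * (f x * (1 - Real.log (f x))) * r ^ 2
        * volume.real (Metric.closedBall x r) := by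
  have hcont := hf.differentiable.continuous
  have hfin : volume (Metric.closedBall x r) < ∞ := (isCompact_closedBall x r).measure_lt_top
  have hi1 : IntegrableOn f (Metric.closedBall x r) :=
    hcont.continuousOn.integrableOn_compact (isCompact_closedBall x r)
  have hi2 : IntegrableOn (fun _ => f x) (Metric.closedBall x r) :=
    integrableOn_const hfin.ne
  have hi3 : IntegrableOn (fun y => fderiv ℝ f x (y - x)) (Metric.closedBall x r) :=
    (Continuous.continuousOn (by fun_prop)).integrableOn_compact (isCompact_closedBall x r)
  have h := norm_setIntegral_le_of_norm_le_const (μ := volume)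
    (f := fun y => f y - f x - fderiv ℝ f x (y - x)) hfin
    (fun y hy => hf.taylor hpos hCb hCc hr1 hy)
  rw [integral_sub (f := fun y => f y - f x) (hi1.sub hi2) hi3, setIntegral_closedBall_clm_sub, sub_zero,
    integral_sub hi1 hi2, setIntegral_const, smul_eq_mul, mul_comm (volume.real _) (f x)] at h
  exact h

end

/-! ### Counting sample points and the k-th neighbour distance -/

section

section KthDist

variable {d N k : ℕ} {X : Fin N → EuclideanSpace ℝ (Fin d)} {x z : EuclideanSpace ℝ (Fin d)}
  {r r' : ℝ}

lemma kthDist_le (hk : 1 ≤ k) (h : k ≤ Nat.card {i : Fin N // dist x (X i) ≤ r}) :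
    kthDist k X x ≤ r := by
  refine csInf_le ⟨0, fun s hs => ?_⟩ h
  by_contra hneg
  have : IsEmpty {i : Fin N // dist x (X i) ≤ s} :=
    ⟨fun i => hneg (dist_nonneg.trans i.2)⟩
  have h0 : k ≤ 0 := by simpa using hs
  omega

lemma card_dist_le_mono (h : dist x z + r ≤ r') :
    Nat.card {i : Fin N // dist z (X i) ≤ r} ≤ Nat.card {i : Fin N // dist x (X i) ≤ r'} :=
  Nat.card_le_card_of_injective
    (fun i => (⟨i.1, (dist_triangle x z _).trans (by linarith [i.2])⟩ :
      {i : Fin N // dist x (X i) ≤ r'}))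
    (fun a b hab => Subtype.ext (by simpa using hab))

lemma le_kthDist (hk : k ≤ N) (h : Nat.card {i : Fin N // dist x (X i) ≤ r} < k) :
    r ≤ kthDist k X x := by
  refine le_csInf ⟨∑ i, dist x (X i), ?_⟩ (fun s hs => ?_)
  -- The sum of all distances is a radius that captures all `N ≥ k` points, so the infimum is over a
  -- nonempty set.
  · have h1 : ∀ i, dist x (X i) ≤ ∑ j, dist x (X j) := fun i =>
      Finset.single_le_sum (f := fun j => dist x (X j)) (fun j _ => dist_nonneg)
        (Finset.mem_univ i)
    have h2 : Nat.card {i : Fin N // dist x (X i) ≤ ∑ j, dist x (X j)} = N := by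
      rw [Nat.card_congr (Equiv.subtypeUnivEquiv h1), Nat.card_fin]
    exact hk.trans_eq h2.symm
  · by_contra hlt
    have h1 : Nat.card {i : Fin N // dist x (X i) ≤ s}
        ≤ Nat.card {i : Fin N // dist x (X i) ≤ r} :=
      card_dist_le_mono (by rw [dist_self, zero_add]; exact (not_le.1 hlt).le)
    have h2 : k ≤ Nat.card {i : Fin N // dist x (X i) ≤ s} := hs
    omega

lemma card_dist_le_eq_sum (X : Fin N → EuclideanSpace ℝ (Fin d)) (x : EuclideanSpace ℝ (Fin d))
    (r : ℝ) : (Nat.card {i : Fin N // dist x (X i) ≤ r} : ℝ)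
      = ∑ i, (Metric.closedBall x r).indicator 1 (X i) := by
  classical
  rw [Nat.card_eq_fintype_card, Fintype.card_subtype, Finset.card_filter]
  push_cast
  refine Finset.sum_congr rfl fun i _ => ?_
  simp [Set.indicator, dist_comm]

end KthDist

/-! ### Chernoff bounds for sums of independent indicators -/

section Chernoff

variable {Ω E ι : Type*} [MeasurableSpace Ω] {μ : Measure Ω} [IsProbabilityMeasure μ]
  [MeasurableSpace E] {X : ι → Ω → E} {S : Set E} {p : ℝ}

lemma mgf_indicator_comp {Y : Ω → E} (hY : Measurable Y) (hS : MeasurableSet S) (t : ℝ) :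
    mgf (S.indicator 1 ∘ Y) μ t = 1 + μ.real (Y ⁻¹' S) * (Real.exp t - 1) := by
  have h : (fun ω => Real.exp (t * (S.indicator (1 : E → ℝ) ∘ Y) ω))
      = fun ω => 1 + (Y ⁻¹' S).indicator (fun _ => Real.exp t - 1) ω := by
    ext ω
    by_cases hω : Y ω ∈ S <;> simp [Set.indicator, hω]
  rw [mgf, h, integral_add (integrable_const _)
    ((integrable_const _).indicator (hY hS)), integral_indicator (hY hS), setIntegral_const]
  simp

/-- Each factor `1 + p * (exp t - 1)` is at most `exp (p * (exp t - 1))`: the Poisson bound. -/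
lemma mgf_count_le (hX : ∀ i, Measurable (X i)) (hind : iIndepFun X μ) (hS : MeasurableSet S)
    (hp : ∀ i, μ.real (X i ⁻¹' S) = p) (s : Finset ι) (t : ℝ) :
    mgf (∑ i ∈ s, (S.indicator 1 ∘ X i : Ω → ℝ)) μ t
      ≤ Real.exp (s.card * p * (Real.exp t - 1)) := by
  have hm : Measurable (S.indicator (1 : E → ℝ)) := measurable_one.indicator hS
  have hY := hind.comp (fun _ => S.indicator (1 : E → ℝ)) (fun _ => hm)
  rw [hY.mgf_sum (fun i => hm.comp (hX i))]
  have h1 : ∀ i ∈ s, mgf (S.indicator (1 : E → ℝ) ∘ X i) μ t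
      ≤ Real.exp (p * (Real.exp t - 1)) := fun i _ => by
    rw [mgf_indicator_comp (hX i) hS, hp]
    linarith [Real.add_one_le_exp (p * (Real.exp t - 1))]
  refine (Finset.prod_le_prod (fun i _ => mgf_nonneg) h1).trans_eq ?_
  rw [Finset.prod_const, ← Real.exp_nat_mul, mul_assoc]

lemma integrable_exp_mul_count (hX : ∀ i, Measurable (X i)) (hS : MeasurableSet S)
    (s : Finset ι) (t : ℝ) :
    Integrable (fun ω => Real.exp (t * (∑ i ∈ s, (S.indicator 1 ∘ X i : Ω → ℝ)) ω)) μ := by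
  have hm : Measurable (S.indicator (1 : E → ℝ)) := measurable_one.indicator hS
  have hsum : Measurable (∑ i ∈ s, (S.indicator 1 ∘ X i : Ω → ℝ)) := by
    rw [Finset.sum_fn]
    exact Finset.measurable_sum _ fun i _ => hm.comp (hX i)
  refine Integrable.of_bound (C := Real.exp (|t| * s.card))
    (Real.measurable_exp.comp (hsum.const_mul t)).aestronglyMeasurable
    (ae_of_all _ fun ω => ?_)
  rw [Real.norm_of_nonneg (Real.exp_pos _).le, Real.exp_le_exp]
  refine (le_abs_self _).trans ?_
  rw [abs_mul, Finset.sum_apply]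
  refine mul_le_mul_of_nonneg_left ((Finset.abs_sum_le_sum_abs _ _).trans ?_) (abs_nonneg t)
  refine (Finset.sum_le_card_nsmul s _ 1 fun i _ => ?_).trans_eq (by simp)
  by_cases h : X i ω ∈ S <;> simp [h]

lemma measure_count_ge_le (hX : ∀ i, Measurable (X i)) (hind : iIndepFun X μ)
    (hS : MeasurableSet S) (hp : ∀ i, μ.real (X i ⁻¹' S) = p) (s : Finset ι) {t : ℝ}
    (ht : 0 ≤ t) (a : ℝ) :
    μ {ω | a ≤ ∑ i ∈ s, (S.indicator 1 (X i ω) : ℝ)}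
      ≤ ENNReal.ofReal (Real.exp (-t * a + s.card * p * (Real.exp t - 1))) := by
  have h := measure_ge_le_exp_mul_mgf a ht (integrable_exp_mul_count (μ := μ) hX hS s t)
  have h2 := h.trans (mul_le_mul_of_nonneg_left (mgf_count_le hX hind hS hp s t)
    (Real.exp_pos _).le)
  rw [← Real.exp_add] at h2
  rw [← ENNReal.ofReal_toReal (measure_ne_top μ _)]
  refine ENNReal.ofReal_le_ofReal (le_of_eq_of_le ?_ h2)
  simp [Measure.real]

lemma measure_count_le_le (hX : ∀ i, Measurable (X i)) (hind : iIndepFun X μ)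
    (hS : MeasurableSet S) (hp : ∀ i, μ.real (X i ⁻¹' S) = p) (s : Finset ι) {t : ℝ}
    (ht : 0 ≤ t) (a : ℝ) :
    μ {ω | ∑ i ∈ s, (S.indicator 1 (X i ω) : ℝ) ≤ a}
      ≤ ENNReal.ofReal (Real.exp (t * a + s.card * p * (Real.exp (-t) - 1))) := by
  have h := measure_le_le_exp_mul_mgf a (neg_nonpos.2 ht)
    (integrable_exp_mul_count (μ := μ) hX hS s (-t))
  have h2 := h.trans (mul_le_mul_of_nonneg_left (mgf_count_le hX hind hS hp s (-t))
    (Real.exp_pos _).le)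
  rw [← Real.exp_add, neg_neg] at h2
  rw [← ENNReal.ofReal_toReal (measure_ne_top μ _)]
  refine ENNReal.ofReal_le_ofReal (le_of_eq_of_le ?_ h2)
  simp [Measure.real]

/-- A sum of independent indicators exceeds `m` with small probability if its mean is at most
`m / K`. -/
lemma measure_count_ge_le_of_mean_le (hX : ∀ i, Measurable (X i)) (hind : iIndepFun X μ)
    (hS : MeasurableSet S) (hp : ∀ i, μ.real (X i ⁻¹' S) = p) (s : Finset ι) {m K : ℝ}
    (hm : 0 ≤ m) (hK : 1 ≤ K) (hmean : s.card * p * K ≤ m) :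
    μ {ω | m ≤ ∑ i ∈ s, (S.indicator 1 (X i ω) : ℝ)}
      ≤ ENNReal.ofReal (Real.exp (-m * (Real.log K - 1))) := by
  have hK0 : 0 < K := by linarith
  refine (measure_count_ge_le hX hind hS hp s (Real.log_nonneg hK) m).trans
    (ENNReal.ofReal_le_ofReal (Real.exp_le_exp.2 ?_))
  rw [Real.exp_log hK0]
  have h1 : s.card * p ≤ m / K := (le_div_iff₀ hK0).2 hmean
  have h2 : m / K * (K - 1) ≤ m := by
    rw [div_mul_eq_mul_div, div_le_iff₀ hK0]
    nlinarith
  nlinarith [mul_le_mul_of_nonneg_right h1 (sub_nonneg.2 hK)]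

/-- Tilting by `θ / 4` and bounding `exp` to second order leaves an exponent of at most `m * (-θ ^ 2
/ 8 + θ ^ 2 / 16)`. The lower tail below uses the tilt `θ / 8`. -/
lemma measure_count_ge_le_of_gap (hX : ∀ i, Measurable (X i)) (hind : iIndepFun X μ)
    (hS : MeasurableSet S) (hp : ∀ i, μ.real (X i ⁻¹' S) = p) (s : Finset ι) {m θ : ℝ}
    (hm : 0 ≤ m) (hθ : 0 ≤ θ) (hθ1 : θ ≤ 1) (hmean : s.card * p ≤ m * (1 - θ / 2)) :
    μ {ω | m ≤ ∑ i ∈ s, (S.indicator 1 (X i ω) : ℝ)}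
      ≤ ENNReal.ofReal (Real.exp (-(m * θ ^ 2 / 32))) := by
  refine (measure_count_ge_le hX hind hS hp s (t := θ / 4) (by linarith) m).trans
    (ENNReal.ofReal_le_ofReal (Real.exp_le_exp.2 ?_))
  have h1 : Real.exp (θ / 4) - 1 ≤ θ / 4 + (θ / 4) ^ 2 := by
    have := (abs_le.1 (Real.abs_exp_sub_one_sub_id_le (x := θ / 4)
      (by rw [abs_of_nonneg] <;> linarith))).2
    linarith
  have h0 : 0 ≤ Real.exp (θ / 4) - 1 := by
    linarith [Real.add_one_le_exp (θ / 4)]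
  have h2 : s.card * p * (Real.exp (θ / 4) - 1)
      ≤ m * (1 - θ / 2) * (θ / 4 + (θ / 4) ^ 2) :=
    (mul_le_mul_of_nonneg_right hmean h0).trans
      (mul_le_mul_of_nonneg_left h1 (mul_nonneg hm (by linarith)))
  have h3 : 0 ≤ m * θ ^ 2 := by positivity
  have h4 : 0 ≤ m * θ ^ 3 := by positivity
  nlinarith

lemma measure_count_le_le_of_gap (hX : ∀ i, Measurable (X i)) (hind : iIndepFun X μ)
    (hS : MeasurableSet S) (hp : ∀ i, μ.real (X i ⁻¹' S) = p) (s : Finset ι) {m θ : ℝ}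
    (hm : 0 ≤ m) (hθ : 0 ≤ θ) (hθ1 : θ ≤ 1) (hmean : m * (1 + θ / 2) ≤ s.card * p) :
    μ {ω | ∑ i ∈ s, (S.indicator 1 (X i ω) : ℝ) ≤ m}
      ≤ ENNReal.ofReal (Real.exp (-(m * θ ^ 2 / 32))) := by
  refine (measure_count_le_le hX hind hS hp s (t := θ / 8) (by linarith) m).trans
    (ENNReal.ofReal_le_ofReal (Real.exp_le_exp.2 ?_))
  have h1 : Real.exp (-(θ / 8)) - 1 ≤ -(θ / 8) + (θ / 8) ^ 2 := by
    have := (abs_le.1 (Real.abs_exp_sub_one_sub_id_le (x := -(θ / 8))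
      (by rw [abs_neg, abs_of_nonneg] <;> linarith))).2
    linarith
  have h0 : Real.exp (-(θ / 8)) - 1 ≤ 0 := by
    linarith [Real.exp_le_one_iff.2 (show -(θ / 8) ≤ 0 by linarith)]
  have h2 : s.card * p * (Real.exp (-(θ / 8)) - 1)
      ≤ m * (1 + θ / 2) * (-(θ / 8) + (θ / 8) ^ 2) :=
    (mul_le_mul_of_nonpos_right hmean h0).trans
      (mul_le_mul_of_nonneg_left h1 (mul_nonneg hm (by linarith)))
  have h3 : m * θ ^ 3 ≤ m * θ ^ 2 :=
    mul_le_mul_of_nonneg_left (pow_le_pow_of_le_one hθ hθ1 (by norm_num)) hm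
  have h4 : 0 ≤ m * θ ^ 2 := by positivity
  nlinarith

end Chernoff

end

/-! ### Empirical counts in balls: sample-point centres and fixed centres -/

section

/-- `X i` is independent of the points in `s`, so Fubini reduces the random centre to fixed ones:
the section over `y` has measure at most `δ` for `y ∈ G` and is empty otherwise. -/
lemma measure_leave_one_out_le {Ω E ι : Type*} [MeasurableSpace Ω] {μ : Measure Ω}
    [IsProbabilityMeasure μ] [PseudoMetricSpace E] [SecondCountableTopology E]
    [MeasurableSpace E] [BorelSpace E] [DecidableEq ι] {X : ι → Ω → E}
    (hX : ∀ i, Measurable (X i)) (hind : iIndepFun X μ) (i : ι) {s : Finset ι} (hi : i ∉ s)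
    {G : Set E} (hG : MeasurableSet G) (r m : ℝ) {δ : ℝ≥0∞}
    (h : ∀ y ∈ G, μ {ω | m ≤ ∑ j ∈ s, ((Metric.closedBall y r).indicator 1 (X j ω) : ℝ)} ≤ δ) :
    μ {ω | X i ω ∈ G ∧ m ≤ ∑ j ∈ s, ((Metric.closedBall (X i ω) r).indicator 1 (X j ω) : ℝ)}
      ≤ δ := by
  set Z : Ω → (s → E) := fun ω j => X j ω with hZ
  have hZm : Measurable Z := measurable_pi_lambda _ fun j => hX j
  have hindep : IndepFun (X i) Z μ :=
    (hind.indepFun_finset {i} s (Finset.disjoint_singleton_left.2 hi) hX).comp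
      (φ := fun a : (({i} : Finset ι) → E) => a ⟨i, Finset.mem_singleton_self i⟩) (ψ := id)
      (measurable_pi_apply _) measurable_id
  set T : Set (E × (s → E)) := {q | q.1 ∈ G ∧
    m ≤ ∑ j, ((Metric.closedBall q.1 r).indicator 1 (q.2 j) : ℝ)} with hT
  have hTm : MeasurableSet T := by
    suffices h : ∀ j, Measurable fun q : E × (s → E) =>
        ((Metric.closedBall q.1 r).indicator 1 (q.2 j) : ℝ) from
      (measurable_fst hG).inter (measurableSet_le
        (f := fun _ : E × (s → E) => m) measurable_const
        (Finset.measurable_sum Finset.univ fun j _ => h j))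
    intro j
    have h1 : MeasurableSet {q : E × (s → E) | dist (q.2 j) q.1 ≤ r} :=
      measurableSet_le (((measurable_pi_apply j).comp measurable_snd).dist measurable_fst)
        measurable_const
    exact (measurable_one (α := ℝ)).indicator h1
  have hsum : ∀ (y : E) (ω : Ω), ∑ j : s, ((Metric.closedBall y r).indicator 1 (Z ω j) : ℝ)
      = ∑ j ∈ s, ((Metric.closedBall y r).indicator 1 (X j ω) : ℝ) := fun y ω =>
    Finset.sum_coe_sort s fun j => ((Metric.closedBall y r).indicator 1 (X j ω) : ℝ)
  have heq : {ω | X i ω ∈ G ∧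
      m ≤ ∑ j ∈ s, ((Metric.closedBall (X i ω) r).indicator 1 (X j ω) : ℝ)}
      = (fun ω => (X i ω, Z ω)) ⁻¹' T := by
    ext ω
    simp only [hT, Set.mem_ofPred_eq, Set.mem_preimage, hsum]
  have hprob := Measure.isProbabilityMeasure_map (μ := μ) (hX i).aemeasurable
  have hprob' := Measure.isProbabilityMeasure_map (μ := μ) hZm.aemeasurable
  rw [heq, ← Measure.map_apply ((hX i).prodMk hZm) hTm,
    (indepFun_iff_map_prod_eq_prod_map_map (hX i).aemeasurable hZm.aemeasurable).1 hindep,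
    Measure.prod_apply hTm]
  refine (lintegral_mono (g := fun _ => δ) fun y => ?_).trans_eq (by simp)
  rw [Measure.map_apply hZm (measurable_prodMk_left hTm)]
  by_cases hy : y ∈ G
  · refine (measure_mono fun ω hω => ?_).trans (h y hy)
    have := hω.2
    rwa [hsum] at this
  · refine (measure_mono_null (fun ω hω => hy hω.1) measure_empty).trans_le zero_le

variable {d N k : ℕ} {Cb Cc : ℝ} {f : EuclideanSpace ℝ (Fin d) → ℝ}

lemma measureReal_preimage_eq_setIntegral {Ω : Type*} [MeasurableSpace Ω] {μ : Measure Ω}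
    {Y : Ω → EuclideanSpace ℝ (Fin d)} (hY : Measurable Y) (h0 : ∀ x, 0 ≤ f x)
    (hf : Continuous f)
    (hlaw : μ.map Y = volume.withDensity (fun x => ENNReal.ofReal (f x)))
    {S : Set (EuclideanSpace ℝ (Fin d))} (hS : MeasurableSet S) :
    μ.real (Y ⁻¹' S) = ∫ y in S, f y := by
  rw [integral_eq_lintegral_of_nonneg_ae (ae_of_all _ h0) hf.aestronglyMeasurable,
    ← withDensity_apply _ hS, ← hlaw, Measure.map_apply hY hS, Measure.real]

lemma setIntegral_closedBall_le {s r : ℝ} {x : EuclideanSpace ℝ (Fin d)} (hf : Continuous f)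
    (h : ∀ y ∈ Metric.closedBall x r, f y ≤ s) :
    ∫ y in Metric.closedBall x r, f y ≤ s * volume.real (Metric.closedBall x r) := by
  have hc := isCompact_closedBall x r
  refine (setIntegral_mono_on (hf.continuousOn.integrableOn_compact hc)
    (integrableOn_const hc.measure_lt_top.ne) Metric.isClosed_closedBall.measurableSet h).trans_eq
    ?_
  rw [setIntegral_const, smul_eq_mul, mul_comm]

section Sample

variable {Ω : Type*} [MeasurableSpace Ω] {μ : Measure Ω} [IsProbabilityMeasure μ]
  {X : Fin N → Ω → EuclideanSpace ℝ (Fin d)}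

/-- With high probability no ball of radius `r` centred in `D` contains `k` sample points, if the
density is small near `D`. -/
lemma measure_exists_card_ge_le (hX : ∀ i, Measurable (X i)) (hind : iIndepFun X μ)
    (hlaw : ∀ i, μ.map (X i) = volume.withDensity (fun x => ENNReal.ofReal (f x)))
    (h0 : ∀ x, 0 ≤ f x) (hf : Continuous f) (hk : 1 ≤ k) {D : Set (EuclideanSpace ℝ (Fin d))}
    {s r K : ℝ} (hK : 1 ≤ K)
    (hD : ∀ x ∈ D, ∀ y ∈ Metric.closedBall x (3 * r), f y ≤ s)
    (hmean : N * (s * volume.real (Metric.closedBall (0 : EuclideanSpace ℝ (Fin d)) (2 * r))) * K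
      ≤ (k : ℝ) - 1) :
    μ {ω | ∃ x ∈ D, k ≤ Nat.card {i : Fin N // dist x (X i ω) ≤ r}}
      ≤ ENNReal.ofReal (N * Real.exp (-((k : ℝ) - 1) * (Real.log K - 1))) := by
  -- The admissible random centres. This set is closed, hence measurable, whereas nothing is assumed
  -- about measurability of `D`.
  set G : Set (EuclideanSpace ℝ (Fin d)) :=
    {y | ∀ h ∈ Metric.closedBall (0 : EuclideanSpace ℝ (Fin d)) (2 * r), f (y + h) ≤ s} with hG
  have hGc : IsClosed G := by
    have : G = ⋂ h ∈ Metric.closedBall (0 : EuclideanSpace ℝ (Fin d)) (2 * r),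
        {y | f (y + h) ≤ s} := by
      ext y
      simp [hG]
    rw [this]
    exact isClosed_biInter fun h _ =>
      isClosed_le (hf.comp (continuous_id.add continuous_const)) continuous_const
  have hk1 : (0 : ℝ) ≤ (k : ℝ) - 1 := by
    have : (1 : ℝ) ≤ k := by exact_mod_cast hk
    linarith
  set δ := ENNReal.ofReal (Real.exp (-((k : ℝ) - 1) * (Real.log K - 1))) with hδ
  have hi : ∀ i, μ {ω | X i ω ∈ G ∧ (k : ℝ) - 1 ≤ ∑ j ∈ Finset.univ.erase i,
      ((Metric.closedBall (X i ω) (2 * r)).indicator 1 (X j ω) : ℝ)} ≤ δ := by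
    intro i
    refine measure_leave_one_out_le hX hind i (Finset.notMem_erase _ _) hGc.measurableSet _ _
      fun y hy => ?_
    refine measure_count_ge_le_of_mean_le hX hind Metric.isClosed_closedBall.measurableSet
      (fun j => measureReal_preimage_eq_setIntegral (hX j) h0 hf (hlaw j)
        Metric.isClosed_closedBall.measurableSet) _ hk1 hK (le_trans ?_ hmean)
    have hp : ∫ w in Metric.closedBall y (2 * r), f w ≤ s * volume.real
        (Metric.closedBall (0 : EuclideanSpace ℝ (Fin d)) (2 * r)) := by
      rw [← Measure.addHaar_real_closedBall_center volume y]
      refine setIntegral_closedBall_le hf fun w hw => ?_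
      have := hy (w - y) (by simpa [dist_eq_norm] using hw)
      simpa using this
    have hp0 : 0 ≤ ∫ w in Metric.closedBall y (2 * r), f w :=
      integral_nonneg h0
    have hcard : ((Finset.univ.erase i).card : ℝ) ≤ N := by
      exact_mod_cast (Finset.card_le_univ _).trans_eq (Fintype.card_fin N)
    exact mul_le_mul_of_nonneg_right (mul_le_mul hcard hp hp0 (Nat.cast_nonneg _)) (by linarith)
  have hsub : {ω | ∃ x ∈ D, k ≤ Nat.card {i : Fin N // dist x (X i ω) ≤ r}}
      ⊆ ⋃ i, {ω | X i ω ∈ G ∧ (k : ℝ) - 1 ≤ ∑ j ∈ Finset.univ.erase i,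
        ((Metric.closedBall (X i ω) (2 * r)).indicator 1 (X j ω) : ℝ)} := by
    rintro ω ⟨x, hx, hcard⟩
    -- Recentre at a sample point in the ball. The radius doubles to `2 * r`, and this larger ball
    -- lies within `3 * r` of `x`.
    obtain ⟨i, hi⟩ : Nonempty {i : Fin N // dist x (X i ω) ≤ r} :=
      (Nat.card_pos_iff.1 (by omega)).1
    refine Set.mem_iUnion.2 ⟨i, fun h hh => hD x hx _ ?_, ?_⟩
    · rw [Metric.mem_closedBall, dist_comm]
      have h1 : dist (X i ω) (X i ω + h) ≤ 2 * r := by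
        rw [dist_self_add_right]
        simpa using hh
      linarith [dist_triangle x (X i ω) (X i ω + h)]
    · have h1 : k ≤ Nat.card {j : Fin N // dist (X i ω) (X j ω) ≤ 2 * r} :=
        hcard.trans (card_dist_le_mono (X := fun i => X i ω) (by rw [dist_comm]; linarith))
      have h2 : (k : ℝ) ≤ _ := (Nat.cast_le.2 h1).trans_eq
        (card_dist_le_eq_sum (fun j => X j ω) (X i ω) (2 * r))
      -- The centre counts itself once, which leaves `k - 1` of the other points.
      rw [← Finset.add_sum_erase _ _ (Finset.mem_univ i)] at h2
      have h3 : ((Metric.closedBall (X i ω) (2 * r)).indicator 1 (X i ω) : ℝ) ≤ 1 :=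
        Set.indicator_le_self' (fun _ _ => zero_le_one) _
      linarith
  refine (measure_mono hsub).trans ((measure_iUnion_le _).trans ?_)
  rw [tsum_fintype]
  refine (Finset.sum_le_card_nsmul _ _ δ fun i _ => hi i).trans_eq ?_
  rw [Finset.card_univ, Fintype.card_fin, nsmul_eq_mul, ENNReal.ofReal_mul (Nat.cast_nonneg _),
    ENNReal.ofReal_natCast]

section Pointwise

variable (hX : ∀ i, Measurable (X i)) (hind : iIndepFun X μ)
  (hlaw : ∀ i, μ.map (X i) = volume.withDensity (fun x => ENNReal.ofReal (f x)))
  (hf : SmoothTail Cb Cc f) (hpos : ∀ x, 0 < f x) (hCb : 0 ≤ Cb) (hCc : 0 ≤ Cc)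
  (hN : 0 < N) {z : EuclideanSpace ℝ (Fin d)} {R θ : ℝ} (hR : 0 ≤ R)
  (hRk : volume.real (Metric.ball (0 : EuclideanSpace ℝ (Fin d)) 1) * R ^ d * f z = k / N)
  (hsmall : 2 * Cb * R * (1 - Real.log (f z)) ≤ 1) (hθ0 : 0 ≤ θ) (hθ : θ ≤ 1)
  (hθR : 16 * (Cc * Real.exp 2) * (R ^ 2 * (1 - Real.log (f z))) ≤ θ)

include hf hpos hCb hCc hN hR hRk hsmall hθR in
-- For a constant density the expected count at radius `R * q` would be `k * q ^ d`. The relative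
-- bias is at most `Cc * exp 2 * R ^ 2 * (1 - log (f z)) * q ^ 2`; the first factors contribute `θ /
-- 16` and `q ^ 2 ≤ 4`.
lemma abs_mul_setIntegral_sub_le {q : ℝ} (hq0 : 0 ≤ q) (hq2 : q ≤ 2) :
    |N * (∫ y in Metric.closedBall z (R * q), f y) - k * q ^ d| ≤ k * q ^ d * (θ / 4) := by
  have hlog : 0 ≤ -Real.log (f z) := neg_nonneg.2 (Real.log_nonpos (hpos z).le (hf.le_one z))
  have h := hf.abs_setIntegral_sub_le hpos hCb hCc (x := z) (r := R * q) (by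
    refine le_trans (mul_le_mul_of_nonneg_right ?_ (by linarith)) hsmall
    nlinarith [mul_nonneg hCb hR])
  have hN' : (0 : ℝ) < N := by exact_mod_cast hN
  have hvol : N * (f z * volume.real (Metric.closedBall z (R * q))) = k * q ^ d := by
    rw [Measure.addHaar_real_closedBall _ _ (mul_nonneg hR hq0), finrank_euclideanSpace_fin,
      mul_pow]
    calc _ = N * (volume.real (Metric.ball (0 : EuclideanSpace ℝ (Fin d)) 1) * R ^ d * f z)
          * q ^ d := by ring
      _ = _ := by rw [hRk]; field_simp
  have hq4 : q ^ 2 ≤ 4 := by nlinarith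
  have hkq : (0 : ℝ) ≤ k * q ^ d := by positivity
  rw [← hvol, ← mul_sub, abs_mul, abs_of_pos hN', hvol]
  calc N * |(∫ y in Metric.closedBall z (R * q), f y)
          - f z * volume.real (Metric.closedBall z (R * q))|
      ≤ N * (Cc * Real.exp 2 * (f z * (1 - Real.log (f z))) * (R * q) ^ 2
        * volume.real (Metric.closedBall z (R * q))) := mul_le_mul_of_nonneg_left h hN'.le
    _ = (N * (f z * volume.real (Metric.closedBall z (R * q))))
        * ((Cc * Real.exp 2 * (R ^ 2 * (1 - Real.log (f z)))) * q ^ 2) := by ring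
    _ ≤ k * q ^ d * (θ / 4) := by
      rw [hvol]
      refine mul_le_mul_of_nonneg_left ?_ hkq
      have h0 : 0 ≤ Cc * Real.exp 2 * (R ^ 2 * (1 - Real.log (f z))) :=
        mul_nonneg (mul_nonneg hCc (Real.exp_pos _).le)
          (mul_nonneg (sq_nonneg R) (by linarith))
      nlinarith

include hX hind hlaw hf hpos hCb hCc hN hR hRk hsmall hθ0 hθ hθR in
-- The mean is at least `k * (1 + θ) * (1 - θ / 4)`, which exceeds `k` by the relative gap `θ / 2`
-- that the Chernoff bound needs; inner balls are treated symmetrically below.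
lemma measure_card_lt_le (hd : 1 ≤ d) :
    μ {ω | Nat.card {i : Fin N // dist z (X i ω) ≤ R * (1 + θ)} < k}
      ≤ ENNReal.ofReal (Real.exp (-(k * θ ^ 2 / 32))) := by
  have h := (abs_le.1 (abs_mul_setIntegral_sub_le hf hpos hCb hCc hN hR hRk hsmall hθR
    (q := 1 + θ) (by linarith) (by linarith))).1
  have hq : 1 + θ ≤ (1 + θ) ^ d := le_self_pow₀ (by linarith) (by omega)
  refine (measure_mono fun ω hω => ?_).trans (measure_count_le_le_of_gap hX hind
    Metric.isClosed_closedBall.measurableSet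
      (fun j => measureReal_preimage_eq_setIntegral (hX j) hf.nonneg hf.differentiable.continuous
        (hlaw j) Metric.isClosed_closedBall.measurableSet) Finset.univ (m := k) (θ := θ)
      (S := Metric.closedBall z (R * (1 + θ))) (Nat.cast_nonneg _) hθ0 hθ ?_)
  · rw [Set.mem_ofPred_eq, ← card_dist_le_eq_sum (fun i => X i ω)]
    exact_mod_cast (Set.mem_ofPred_eq ▸ hω).le
  · rw [Finset.card_univ, Fintype.card_fin]
    have h1 : (k : ℝ) * (1 + θ / 2) ≤ k * ((1 + θ) ^ d * (1 - θ / 4)) :=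
      mul_le_mul_of_nonneg_left (by nlinarith) (Nat.cast_nonneg _)
    linarith

include hX hind hlaw hf hpos hCb hCc hN hR hRk hsmall hθ0 hθ hθR in
lemma measure_le_card_le (hd : 1 ≤ d) :
    μ {ω | k ≤ Nat.card {i : Fin N // dist z (X i ω) ≤ R * (1 - θ)}}
      ≤ ENNReal.ofReal (Real.exp (-(k * θ ^ 2 / 32))) := by
  have h := (abs_le.1 (abs_mul_setIntegral_sub_le hf hpos hCb hCc hN hR hRk hsmall hθR
    (q := 1 - θ) (by linarith) (by linarith))).2
  have hq : (1 - θ) ^ d ≤ 1 - θ := pow_le_of_le_one (by linarith) (by linarith) (by omega)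
  refine (measure_mono fun ω hω => ?_).trans (measure_count_ge_le_of_gap hX hind
    Metric.isClosed_closedBall.measurableSet
      (fun j => measureReal_preimage_eq_setIntegral (hX j) hf.nonneg hf.differentiable.continuous
        (hlaw j) Metric.isClosed_closedBall.measurableSet) Finset.univ (m := k) (θ := θ)
      (S := Metric.closedBall z (R * (1 - θ))) (Nat.cast_nonneg _) hθ0 hθ ?_)
  · rw [Set.mem_ofPred_eq, ← card_dist_le_eq_sum (fun i => X i ω)]
    exact_mod_cast (Set.mem_ofPred_eq ▸ hω)
  · rw [Finset.card_univ, Fintype.card_fin]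
    have h1 : (k : ℝ) * ((1 - θ) ^ d * (1 + θ / 4)) ≤ k * (1 - θ / 2) :=
      mul_le_mul_of_nonneg_left (by nlinarith) (Nat.cast_nonneg _)
    linarith

end Pointwise

end Sample

end

/-! ### From neighbour distances to the estimator, pointwise and uniformly -/

section

section Estimator

variable {d N k : ℕ} {X : Fin N → EuclideanSpace ℝ (Fin d)} {x : EuclideanSpace ℝ (Fin d)}

lemma estimator_eq (h : 0 < kthDist k X x) :
    estimator k X x = ((k : ℝ) - 1) / (N * (kthDist k X x ^ d
      * volume.real (Metric.ball (0 : EuclideanSpace ℝ (Fin d)) 1))) := by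
  rw [estimator, Measure.real, Measure.addHaar_ball_of_pos _ _ h, finrank_euclideanSpace_fin,
    ENNReal.toReal_mul, ENNReal.toReal_ofReal (pow_nonneg h.le d), Measure.real]

lemma estimator_nonneg (hk : 1 ≤ k) : 0 ≤ estimator k X x := by
  have : (1 : ℝ) ≤ k := by exact_mod_cast hk
  exact div_nonneg (by linarith) (mul_nonneg (Nat.cast_nonneg _) measureReal_nonneg)

lemma unitBall_pos (d : ℕ) :
    0 < volume.real (Metric.ball (0 : EuclideanSpace ℝ (Fin d)) 1) :=
  ENNReal.toReal_pos (Metric.measure_ball_pos volume _ one_pos).ne'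
    measure_ball_lt_top.ne

lemma estimator_le_of_le_kthDist (hk : 1 ≤ k) (hN : 0 < N) {r c : ℝ} (hr : 0 < r)
    (hc : volume.real (Metric.ball (0 : EuclideanSpace ℝ (Fin d)) 1) * r ^ d * N * c = k - 1)
    (h : r ≤ kthDist k X x) : estimator k X x ≤ c := by
  have hv := unitBall_pos d
  set v := volume.real (Metric.ball (0 : EuclideanSpace ℝ (Fin d)) 1)
  have hN' : (0 : ℝ) < N := by exact_mod_cast hN
  have hk' : (1 : ℝ) ≤ k := by exact_mod_cast hk
  have hρ : 0 < kthDist k X x := hr.trans_le h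
  rw [estimator_eq hρ, div_le_iff₀ (by positivity), ← hc]
  have hc0 : 0 ≤ c := by
    by_contra hneg
    have : v * r ^ d * N * c < 0 := mul_neg_of_pos_of_neg (by positivity) (not_le.1 hneg)
    linarith
  calc v * r ^ d * N * c ≤ v * kthDist k X x ^ d * N * c := by gcongr
    _ = _ := by ring

/-- With `q = R / ρ` the estimator is `a * q ^ d * (1 - 1 / k)`, and `q` lies within `4 * θ` of `1`.
The term `2 ^ d / k` is the cost of `k - 1` in place of `k`. -/
lemma abs_estimator_sub_le (hk : 1 ≤ k) (hN : 0 < N) {R a θ : ℝ} (hR : 0 < R) (ha : 0 ≤ a)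
    (hRk : volume.real (Metric.ball (0 : EuclideanSpace ℝ (Fin d)) 1) * R ^ d * a = k / N)
    (hθ0 : 0 ≤ θ) (hθ : θ ≤ 1 / 4) (h1 : R * (1 - 2 * θ) ≤ kthDist k X x)
    (h2 : kthDist k X x ≤ R * (1 + 2 * θ)) :
    |estimator k X x - a| ≤ a * (2 ^ d / k + d * 2 ^ d * (4 * θ)) := by
  have hv := unitBall_pos d
  set v := volume.real (Metric.ball (0 : EuclideanSpace ℝ (Fin d)) 1) with hvdef
  have hN' : (0 : ℝ) < N := by exact_mod_cast hN
  have hk' : (1 : ℝ) ≤ k := by exact_mod_cast hk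
  have hk0 : (0 : ℝ) < k := by linarith
  have hρ : 0 < kthDist k X x := (mul_pos hR (by linarith)).trans_le h1
  set ρ := kthDist k X x with hρdef
  set q := R / ρ with hq
  have hq0 : 0 < q := div_pos hR hρ
  have hqu : q ≤ 1 + 4 * θ := by
    rw [hq, div_le_iff₀ hρ]
    have : R * 1 ≤ R * ((1 - 2 * θ) * (1 + 4 * θ)) :=
      mul_le_mul_of_nonneg_left (by nlinarith) hR.le
    nlinarith [mul_le_mul_of_nonneg_right h1 (show 0 ≤ 1 + 4 * θ by linarith)]
  have hql : 1 - 4 * θ ≤ q := by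
    rw [hq, le_div_iff₀ hρ]
    have : R * ((1 - 4 * θ) * (1 + 2 * θ)) ≤ R * 1 :=
      mul_le_mul_of_nonneg_left (by nlinarith) hR.le
    nlinarith [mul_le_mul_of_nonneg_left h2 (show 0 ≤ 1 - 4 * θ by linarith)]
  have hest : estimator k X x = a * q ^ d - a * q ^ d / k := by
    rw [estimator_eq hρ, ← hρdef, ← hvdef, hq, div_pow]
    have hk2 : (k : ℝ) = v * R ^ d * a * N := by rw [hRk]; field_simp
    have h3 : a * (R ^ d / ρ ^ d) = k / (N * (ρ ^ d * v)) := by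
      rw [hk2]; field_simp
    rw [h3]
    field_simp
  have hq2 : q ^ d ≤ 2 ^ d := pow_le_pow_left₀ hq0.le (by linarith) d
  have hpow : |q ^ d - 1| ≤ d * 2 ^ d * (4 * θ) := by
    have h := abs_pow_sub_pow_le q 1 d
    rw [one_pow] at h
    have h3 : |q - 1| ≤ 4 * θ := abs_le.2 ⟨by linarith, by linarith⟩
    have h4 : max |q| |1| ^ (d - 1) ≤ (2 : ℝ) ^ d := by
      have : max |q| |1| ≤ 2 := by
        rw [abs_of_pos hq0, abs_one]; exact max_le (by linarith) (by norm_num)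
      exact (pow_le_pow_left₀ (by positivity) this _).trans
        (pow_le_pow_right₀ (by norm_num) (Nat.sub_le _ _))
    calc _ ≤ |q - 1| * d * max |q| |1| ^ (d - 1) := h
      _ ≤ (4 * θ) * d * 2 ^ d := by gcongr
      _ = _ := by ring
  have h5 : estimator k X x - a = a * ((q ^ d - 1) - q ^ d / k) := by rw [hest]; ring
  rw [h5, abs_mul, abs_of_nonneg ha]
  refine mul_le_mul_of_nonneg_left ((abs_sub _ _).trans ?_) ha
  have h6 : |q ^ d / k| ≤ 2 ^ d / k := by
    rw [abs_of_nonneg (by positivity)]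
    gcongr
  linarith

end Estimator

section Sample

variable {d N k : ℕ} {Cb Cc : ℝ} {f : EuclideanSpace ℝ (Fin d) → ℝ}
  {Ω : Type*} [MeasurableSpace Ω] {μ : Measure Ω} [IsProbabilityMeasure μ]
  {X : Fin N → Ω → EuclideanSpace ℝ (Fin d)}

lemma measure_exists_lt_estimator_le (hX : ∀ i, Measurable (X i)) (hind : iIndepFun X μ)
    (hlaw : ∀ i, μ.map (X i) = volume.withDensity (fun x => ENNReal.ofReal (f x)))
    (h0 : ∀ x, 0 ≤ f x) (hf : Continuous f) (hk : 1 ≤ k) (hkN : k ≤ N)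
    {D : Set (EuclideanSpace ℝ (Fin d))} {s r K : ℝ} (hK : 1 ≤ K) (hr : 0 < r)
    (hD : ∀ x ∈ D, ∀ y ∈ Metric.closedBall x (3 * r), f y ≤ s)
    (hrk : volume.real (Metric.ball (0 : EuclideanSpace ℝ (Fin d)) 1) * r ^ d * N
      * (2 ^ d * (K * s)) = k - 1) :
    μ {ω | ∃ x ∈ D, 2 ^ d * (K * s) < estimator k (fun i => X i ω) x}
      ≤ ENNReal.ofReal (N * Real.exp (-((k : ℝ) - 1) * (Real.log K - 1))) := by
  refine (measure_mono ?_).trans (measure_exists_card_ge_le hX hind hlaw h0 hf hk hK hD ?_)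
  · rintro ω ⟨x, hx, hlt⟩
    refine ⟨x, hx, ?_⟩
    by_contra hcard
    exact absurd (estimator_le_of_le_kthDist hk (by omega) hr hrk
      (le_kthDist (X := fun i => X i ω) hkN (not_le.1 hcard))) (not_le.2 hlt)
  · rw [Measure.addHaar_real_closedBall _ _ (by positivity), finrank_euclideanSpace_fin, mul_pow,
      ← hrk]
    exact le_of_eq (by ring)

/-- Uniform accuracy of the estimator on a set `D` with a finite net `F`, where the radius `R z`
of expected mass `k / N` around `z` is small. -/
lemma measure_exists_lt_abs_sub_le (hd : 1 ≤ d) (hX : ∀ i, Measurable (X i))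
    (hind : iIndepFun X μ)
    (hlaw : ∀ i, μ.map (X i) = volume.withDensity (fun x => ENNReal.ofReal (f x)))
    (hf : SmoothTail Cb Cc f) (hpos : ∀ x, 0 < f x) (hCb : 0 ≤ Cb) (hCc : 0 ≤ Cc)
    (hk : 1 ≤ k) (hkN : k ≤ N) {D : Set (EuclideanSpace ℝ (Fin d))}
    {F : Finset (EuclideanSpace ℝ (Fin d))} {δ η b B : ℝ} (hFD : ∀ z ∈ F, z ∈ D)
    (hcover : ∀ x ∈ D, ∃ z ∈ F, dist x z ≤ δ) {R : EuclideanSpace ℝ (Fin d) → ℝ}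
    (hR : ∀ z ∈ D, 0 < R z)
    (hRk : ∀ z ∈ D,
      volume.real (Metric.ball (0 : EuclideanSpace ℝ (Fin d)) 1) * R z ^ d * f z = k / N)
    (hsmall : ∀ z ∈ D, 2 * Cb * R z * (1 - Real.log (f z)) ≤ 1)
    (hη0 : 0 ≤ η) (hη : η ≤ 1 / 8) (hb : 16 * (Cc * Real.exp 2) * b ≤ 1 / 8)
    (hRb : ∀ z ∈ D, R z ^ 2 * (1 - Real.log (f z)) ≤ b)
    (hRB : ∀ z ∈ D, f z * (R z ^ 2 * (1 - Real.log (f z))) ≤ B)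
    (hδ : ∀ z ∈ D, δ ≤ η * R z) :
    μ {ω | ∃ x ∈ D, Cb * δ + 2 ^ d / k + d * 2 ^ d * (4 * (η + 16 * (Cc * Real.exp 2) * B))
      < |estimator k (fun i => X i ω) x - f x|}
      ≤ ENNReal.ofReal (F.card * (2 * Real.exp (-(k * η ^ 2 / 32)))) := by
  have hCe : 0 ≤ 16 * (Cc * Real.exp 2) := by positivity
  -- Stochastic error plus bias. Since `θ z ≥ η`, every net point fails with probability at most
  -- that for `η`.
  set θ : EuclideanSpace ℝ (Fin d) → ℝ :=
    fun z => η + 16 * (Cc * Real.exp 2) * (R z ^ 2 * (1 - Real.log (f z))) with hθdef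
  have hlog : ∀ z, 0 ≤ R z ^ 2 * (1 - Real.log (f z)) := fun z => mul_nonneg (sq_nonneg _)
    (by linarith [Real.log_nonpos (hpos z).le (hf.le_one z)])
  have hηθ : ∀ z, η ≤ θ z := fun z => le_add_of_nonneg_right (mul_nonneg hCe (hlog z))
  have hθ : ∀ z ∈ D, θ z ≤ 1 / 4 := fun z hz => by
    have := mul_le_mul_of_nonneg_left (hRb z hz) hCe
    simp only [hθdef]
    linarith
  have hexp : ∀ z, Real.exp (-(k * θ z ^ 2 / 32)) ≤ Real.exp (-(k * η ^ 2 / 32)) := fun z => by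
    have := pow_le_pow_left₀ hη0 (hηθ z) 2
    gcongr
  set U : EuclideanSpace ℝ (Fin d) → Set Ω := fun z =>
    {ω | Nat.card {i : Fin N // dist z (X i ω) ≤ R z * (1 + θ z)} < k} ∪
    {ω | k ≤ Nat.card {i : Fin N // dist z (X i ω) ≤ R z * (1 - θ z)}} with hU
  have hUle : ∀ z ∈ F, μ (U z) ≤ ENNReal.ofReal (2 * Real.exp (-(k * η ^ 2 / 32))) := by
    intro z hz
    have hzD := hFD z hz
    have hθR : 16 * (Cc * Real.exp 2) * (R z ^ 2 * (1 - Real.log (f z))) ≤ θ z :=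
      le_add_of_nonneg_left hη0
    have h1 := measure_card_lt_le hX hind hlaw hf hpos hCb hCc (by omega) (hR z hzD).le
      (hRk z hzD) (hsmall z hzD) (hη0.trans (hηθ z)) (by linarith [hθ z hzD]) hθR hd
    have h2 := measure_le_card_le hX hind hlaw hf hpos hCb hCc (by omega) (hR z hzD).le
      (hRk z hzD) (hsmall z hzD) (hη0.trans (hηθ z)) (by linarith [hθ z hzD]) hθR hd
    rw [two_mul, ENNReal.ofReal_add (Real.exp_pos _).le (Real.exp_pos _).le]
    exact (measure_union_le _ _).trans (add_le_add
      (h1.trans (ENNReal.ofReal_le_ofReal (hexp z)))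
      (h2.trans (ENNReal.ofReal_le_ofReal (hexp z))))
  refine (measure_mono (t := ⋃ z ∈ F, U z) ?_).trans ((measure_biUnion_finset_le _ _).trans
    ((Finset.sum_le_card_nsmul _ _ _ hUle).trans_eq ?_))
  · rintro ω ⟨x, hx, hlt⟩
    by_contra hω
    obtain ⟨z, hz, hxz⟩ := hcover x hx
    have hzD := hFD z hz
    have hzU : ω ∉ U z := fun h => hω (Set.mem_biUnion hz h)
    simp only [hU, Set.mem_union, Set.mem_ofPred_eq, not_or, not_lt, not_le] at hzU
    have hRz := hR z hzD
    -- Moving from `x` to the net point costs another `R z * θ z`, turning `1 ± θ` into `1 ± 2 * θ`.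
    have hδR : dist x z ≤ R z * θ z := by
      refine hxz.trans ((hδ z hzD).trans ?_)
      rw [mul_comm]
      exact mul_le_mul_of_nonneg_left (hηθ z) hRz.le
    have hup : kthDist k (fun i => X i ω) x ≤ R z * (1 + 2 * θ z) :=
      kthDist_le hk (hzU.1.trans (card_dist_le_mono (X := fun i => X i ω) (by linarith)))
    have hlow : R z * (1 - 2 * θ z) ≤ kthDist k (fun i => X i ω) x :=
      le_kthDist hkN ((card_dist_le_mono (X := fun i => X i ω) (z := x) (x := z)
        (by rw [dist_comm]; linarith)).trans_lt hzU.2)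
    have hest := abs_estimator_sub_le hk (by omega) hRz (hpos z).le (hRk z hzD)
      (hη0.trans (hηθ z)) (hθ z hzD) hlow hup
    have hfx : |f z - f x| ≤ Cb * δ :=
      (hf.abs_sub_le hCb x z).trans (mul_le_mul_of_nonneg_left hxz hCb)
    have hmul : f z * (2 ^ d / k + d * 2 ^ d * (4 * θ z))
        ≤ 2 ^ d / k + d * 2 ^ d * (4 * (η + 16 * (Cc * Real.exp 2) * B)) := by
      have e1 : f z * (2 ^ d / k) ≤ 2 ^ d / k :=
        mul_le_of_le_one_left (by positivity) (hf.le_one z)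
      -- Only the absolute bias, weighted by `f z`, is bounded by `B`; the relative bias is merely
      -- at most a constant.
      have e2 : f z * θ z ≤ η + 16 * (Cc * Real.exp 2) * B := by
        have := mul_le_mul_of_nonneg_left (hRB z hzD) hCe
        have := mul_le_of_le_one_left hη0 (hf.le_one z)
        simp only [hθdef]
        linarith
      have e3 := mul_le_mul_of_nonneg_left e2 (show (0 : ℝ) ≤ d * 2 ^ d * 4 by positivity)
      linarith
    have := abs_sub_le (estimator k (fun i => X i ω) x) (f z) (f x)
    linarith
  · rw [nsmul_eq_mul, ENNReal.ofReal_mul (Nat.cast_nonneg _), ENNReal.ofReal_natCast]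

end Sample

end

/-! ### The density threshold and the bias rate -/

section

lemma exists_pow_mul_eq {d : ℕ} (hd : 1 ≤ d) {v c : ℝ} (hv : 0 < v) (hc : 0 < c) :
    ∃ r : ℝ, 0 < r ∧ v * r ^ d = c := by
  refine ⟨(c / v) ^ ((d : ℝ)⁻¹), Real.rpow_pos_of_pos (div_pos hc hv) _, ?_⟩
  rw [Real.rpow_inv_natCast_pow (div_pos hc hv).le (by omega)]
  field_simp

/-- The part of the rate that bounds the bias. -/
noncomputable def biasRate (d N k : ℕ) : ℝ :=
  if 2 < d then ((k : ℝ) / N) ^ ((2 : ℝ) / d) else (k : ℝ) / N * Real.log N ^ d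

lemma rate_eq (d N k : ℕ) (ε : ℝ) :
    rate d N k ε = biasRate d N k + √(Real.log (N / ε) / k) := by
  have h : (k : ℝ) ^ (-(1 / 2) : ℝ) * √(Real.log (N / ε)) = √(Real.log (N / ε) / k) := by
    rw [Real.sqrt_div' _ (Nat.cast_nonneg k), Real.rpow_neg (Nat.cast_nonneg k),
      ← Real.sqrt_eq_rpow, inv_mul_eq_div]
  unfold rate biasRate
  split_ifs <;> rw [h]

/-- With `u = -log a`, `1 + u ≤ n * (1 + u / n) ≤ n * exp (u / n)`; the `n`-th power cancels `a`. -/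
lemma one_sub_log_pow_mul_le (n : ℕ) (hn : 1 ≤ n) {a : ℝ} (ha : 0 < a) (ha1 : a ≤ 1) :
    (1 - Real.log a) ^ n * a ≤ n ^ n := by
  have hn' : (1 : ℝ) ≤ n := by exact_mod_cast hn
  have hlog := Real.log_nonpos ha.le ha1
  have h1 : 1 - Real.log a ≤ n * Real.exp (-Real.log a / n) := by
    have h2 := Real.add_one_le_exp (-Real.log a / n)
    calc 1 - Real.log a ≤ n + -Real.log a := by linarith
      _ = n * (-Real.log a / n + 1) := by field_simp; ring
      _ ≤ _ := mul_le_mul_of_nonneg_left h2 (by linarith)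
  calc (1 - Real.log a) ^ n * a ≤ (n * Real.exp (-Real.log a / n)) ^ n * a :=
        mul_le_mul_of_nonneg_right (pow_le_pow_left₀ (by linarith) h1 n) ha.le
    _ = n ^ n := by
      rw [mul_pow, ← Real.exp_nat_mul]
      have : (n : ℝ) * (-Real.log a / n) = -Real.log a := by field_simp
      rw [this, Real.exp_neg, Real.exp_log ha]
      field_simp

section Rates

variable {N k : ℕ}

lemma half_lt_log (hN : 2 ≤ N) : 1 / 2 < Real.log N := by
  have h1 : Real.log 2 ≤ Real.log N :=
    Real.log_le_log (by norm_num) (by exact_mod_cast hN)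
  linarith [Real.log_two_gt_d9]

lemma one_sub_log_le_of_inv_le (hN : 2 ≤ N) {t : ℝ} (ht : (1 : ℝ) / N ≤ t) :
    1 - Real.log t ≤ 3 * Real.log N := by
  have hN' : (0 : ℝ) < N := by positivity
  have h1 := Real.log_le_log (by positivity) ht
  rw [one_div, Real.log_inv] at h1
  linarith [half_lt_log hN]

/-- The properties that the threshold `t` between low and high density has to satisfy. -/
structure GoodThreshold (d N k : ℕ) (v β C t : ℝ) : Prop where
  radius_le : ∀ r, 0 ≤ r → v * r ^ d * t ≤ (k : ℝ) / N → r * (1 - Real.log t) ≤ β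
  bias_le : ∀ a r, t ≤ a → a ≤ 1 → 0 ≤ r → v * r ^ d * a = (k : ℝ) / N →
    a * (r ^ 2 * (1 - Real.log a)) ≤ C * t

/-- As `t ≥ 1 / N`, every logarithm is at most `3 * log N`. The factor `log N ^ d` in `t` is what
keeps `r * log N` bounded, and a large `M` makes it small. The bias is `κ * r * (1 - log a) / v` for
`d = 1` and `κ * (1 - log a) / v` for `d = 2`, where `κ = k / N`. -/
lemma exists_threshold_of_le_two {d : ℕ} (hd : 1 ≤ d) (hd2 : d ≤ 2) {v β : ℝ} (hv : 0 < v)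
    (hβ : 0 < β) : ∃ M : ℝ, 1 ≤ M ∧ ∃ C : ℝ, 0 < C ∧ ∀ N k : ℕ, 2 ≤ k → k ≤ N →
      (1 : ℝ) / N ≤ M * ((k : ℝ) / N * Real.log N ^ d) ∧
      (M * ((k : ℝ) / N * Real.log N ^ d) ≤ 1 →
        GoodThreshold d N k v β C (M * ((k : ℝ) / N * Real.log N ^ d))) := by
  -- The `4` compensates for `log N ^ d ≥ 1 / 4`, giving `k / N ≤ t`; the other entry enforces the
  -- radius bound.
  set M : ℝ := max 4 (3 ^ d / (v * β ^ d)) with hM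
  have hM4 : (4 : ℝ) ≤ M := le_max_left _ _
  have hMβ : 3 ^ d / (v * β ^ d) ≤ M := le_max_right _ _
  refine ⟨M, by linarith, 2 * β / v + 6 / v, by positivity, fun N k hk hkN => ?_⟩
  have hN : 2 ≤ N := hk.trans hkN
  have hN' : (0 : ℝ) < N := by positivity
  have hk' : (2 : ℝ) ≤ k := by exact_mod_cast hk
  have hl := half_lt_log hN
  set l := Real.log N with hldef
  have hl0 : 0 < l := by linarith
  set κ : ℝ := (k : ℝ) / N with hκ
  have hκ0 : 0 < κ := by positivity
  have hκN : 1 / (N : ℝ) ≤ κ := by rw [hκ]; gcongr; linarith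
  have hl4 : 1 / 4 ≤ l ^ d := by
    have h1 : ((1 : ℝ) / 2) ^ d ≤ l ^ d := pow_le_pow_left₀ (by norm_num) hl.le d
    have h2 : ((1 : ℝ) / 2) ^ 2 ≤ (1 / 2) ^ d :=
      pow_le_pow_of_le_one (by norm_num) (by norm_num) hd2
    norm_num at h2
    linarith
  have hκt : κ ≤ M * (κ * l ^ d) := by
    calc κ = 4 * (κ * (1 / 4)) := by ring
      _ ≤ M * (κ * l ^ d) := by gcongr
  have ht0 : 0 < M * (κ * l ^ d) := by positivity
  refine ⟨hκN.trans hκt, fun ht1 => ?_⟩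
  set t := M * (κ * l ^ d) with ht
  have hlogt : 1 - Real.log t ≤ 3 * l := one_sub_log_le_of_inv_le hN (hκN.trans hκt)
  have hlogt0 : 0 ≤ 1 - Real.log t := by linarith [Real.log_nonpos ht0.le ht1]
  have hrad : ∀ r, 0 ≤ r → v * r ^ d * t ≤ κ → r * (1 - Real.log t) ≤ β := by
    intro r hr hrt
    refine (mul_le_mul_of_nonneg_left hlogt hr).trans ?_
    refine le_of_pow_le_pow_left₀ (n := d) (by omega) hβ.le ?_
    have h1 : v * r ^ d * (M * l ^ d) ≤ 1 := by
      have : κ * (v * r ^ d * (M * l ^ d)) ≤ κ * 1 := by rw [mul_one]; convert hrt using 1; ring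
      exact le_of_mul_le_mul_left this hκ0
    have h2 : 3 ^ d ≤ M * (v * β ^ d) := (div_le_iff₀ (by positivity)).1 hMβ
    have h3 : (r * l) ^ d * (M * v) ≤ 1 := by rw [mul_pow]; linarith
    calc (r * (3 * l)) ^ d = 3 ^ d * (r * l) ^ d := by rw [← mul_pow]; ring
      _ ≤ M * (v * β ^ d) * (r * l) ^ d := by gcongr
      _ = ((r * l) ^ d * (M * v)) * β ^ d := by ring
      _ ≤ 1 * β ^ d := by gcongr
      _ = β ^ d := one_mul _
  refine ⟨hrad, fun a r hta ha1 hr hra => ?_⟩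
  rw [← hκ] at hra
  have ha0 : 0 < a := ht0.trans_le hta
  have hlog : 1 - Real.log a ≤ 1 - Real.log t := by linarith [Real.log_le_log ht0 hta]
  have hloga : 0 ≤ 1 - Real.log a := by linarith [Real.log_nonpos ha0.le ha1]
  have hrβ : r * (1 - Real.log a) ≤ β := by
    refine (mul_le_mul_of_nonneg_left hlog hr).trans (hrad r hr ?_)
    rw [← hra]
    gcongr
  have e1 : 2 * β / v + 6 / v = (2 * β + 6) / v := by ring
  rw [e1, div_mul_eq_mul_div, le_div_iff₀ hv]
  obtain rfl | rfl : d = 1 ∨ d = 2 := by omega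
  · rw [pow_one] at hra
    calc a * (r ^ 2 * (1 - Real.log a)) * v = κ * (r * (1 - Real.log a)) := by rw [← hra]; ring
      _ ≤ t * β := mul_le_mul hκt hrβ (mul_nonneg hr hloga) ht0.le
      _ ≤ _ := by nlinarith
  · have h6 : κ * (3 * l) ≤ 6 * t := by
      have : κ * l * 1 ≤ κ * l * (2 * l) := by gcongr; linarith
      have : 1 * (κ * l ^ 2) ≤ M * (κ * l ^ 2) := by gcongr; linarith
      nlinarith
    calc a * (r ^ 2 * (1 - Real.log a)) * v = κ * (1 - Real.log a) := by rw [← hra]; ring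
      _ ≤ κ * (3 * l) := by gcongr; linarith
      _ ≤ 6 * t := h6
      _ ≤ _ := by nlinarith

/-- Write `k / N = s ^ d`, so `t = M * s ^ 2`. Then `r ^ d` is at most a multiple of `s ^ (d - 2) ≤
s`, which beats the logarithm. No logarithm survives in the bias, because for `d > 2` a positive
power of `a` is left to absorb it. -/
lemma exists_threshold_of_two_lt {d : ℕ} (hd : 2 < d) {v β : ℝ} (hv : 0 < v) (hβ : 0 < β) :
    ∃ M : ℝ, 1 ≤ M ∧ ∃ C : ℝ, 0 < C ∧ ∀ N k : ℕ, 2 ≤ k → k ≤ N →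
      (1 : ℝ) / N ≤ M * ((k : ℝ) / N) ^ ((2 : ℝ) / d) ∧
      (M * ((k : ℝ) / N) ^ ((2 : ℝ) / d) ≤ 1 →
        GoodThreshold d N k v β C (M * ((k : ℝ) / N) ^ ((2 : ℝ) / d))) := by
  have hd0 : (0 : ℝ) < d := by positivity
  have hd1 : (1 : ℝ) ≤ d := by exact_mod_cast (show 1 ≤ d by omega)
  set M : ℝ := max 1 ((2 * d) ^ d / (v * β ^ d)) with hM
  have hM1 : (1 : ℝ) ≤ M := le_max_left _ _
  have hMβ : (2 * d) ^ d / (v * β ^ d) ≤ M := le_max_right _ _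
  refine ⟨M, hM1, d * max 1 (1 / v ^ 2), by positivity, fun N k hk hkN => ?_⟩
  have hN : 2 ≤ N := hk.trans hkN
  have hN' : (0 : ℝ) < N := by positivity
  have hk' : (2 : ℝ) ≤ k := by exact_mod_cast hk
  obtain ⟨s, hs0, hs⟩ := exists_pow_mul_eq (d := d) (by omega) one_pos
    (show (0 : ℝ) < (k : ℝ) / N by positivity)
  rw [one_mul] at hs
  have hκ1 : (k : ℝ) / N ≤ 1 := (div_le_one hN').2 (by exact_mod_cast hkN)
  have hs1 : s ≤ 1 := by
    rw [← hs] at hκ1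
    exact (pow_le_one_iff_of_nonneg hs0.le (by omega)).1 hκ1
  have hpow : ((k : ℝ) / N) ^ ((2 : ℝ) / d) = s ^ 2 := by
    rw [← hs, ← Real.rpow_natCast s d, ← Real.rpow_mul hs0.le]
    rw [mul_div_cancel₀ _ hd0.ne']
    exact_mod_cast Real.rpow_natCast s 2
  have hκN : 1 / (N : ℝ) ≤ s ^ d := by rw [hs]; gcongr; linarith
  have hsd : s ^ d ≤ s ^ 2 := pow_le_pow_of_le_one hs0.le hs1 hd.le
  have hst : s ^ 2 ≤ M * s ^ 2 := le_mul_of_one_le_left (by positivity) hM1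
  rw [hpow]
  refine ⟨by linarith, fun ht1 => ?_⟩
  have ht0 : 0 < M * s ^ 2 := by positivity
  have hlogs := Real.log_nonpos hs0.le hs1
  have hlogt : 1 - Real.log (M * s ^ 2) ≤ 2 * (1 - Real.log s) := by
    have h1 := Real.log_le_log (by positivity) hst
    rw [Real.log_pow] at h1
    push_cast at h1
    linarith
  constructor
  · rw [← hs]
    intro r hr hrt
    refine (mul_le_mul_of_nonneg_left hlogt hr).trans ?_
    refine le_of_pow_le_pow_left₀ (n := d) (by omega) hβ.le ?_
    have h1 : v * r ^ d * M ≤ s := by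
      have h2 : s ^ d ≤ s ^ 2 * s := by
        rw [← pow_succ]
        exact pow_le_pow_of_le_one hs0.le hs1 hd
      have : s ^ 2 * (v * r ^ d * M) ≤ s ^ 2 * s := by linarith
      exact le_of_mul_le_mul_left this (by positivity)
    have h2 : (2 * d) ^ d ≤ M * (v * β ^ d) := (div_le_iff₀ (by positivity)).1 hMβ
    have h3 := one_sub_log_pow_mul_le d (by omega) hs0 hs1
    have h4 : 0 ≤ (1 - Real.log s) ^ d := pow_nonneg (by linarith) d
    have h5 : v * M * (r * (2 * (1 - Real.log s))) ^ d ≤ v * M * β ^ d := by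
      calc v * M * (r * (2 * (1 - Real.log s))) ^ d
          = 2 ^ d * ((v * r ^ d * M) * (1 - Real.log s) ^ d) := by rw [mul_pow, mul_pow]; ring
        _ ≤ 2 ^ d * (s * (1 - Real.log s) ^ d) := by gcongr
        _ ≤ 2 ^ d * d ^ d := by gcongr; linarith
        _ = (2 * d) ^ d := by rw [mul_pow]
        _ ≤ _ := by linarith
    exact le_of_mul_le_mul_left h5 (by positivity)
  · rw [← hs]
    intro a r hta ha1 hr hra
    have ha0 : 0 < a := ht0.trans_le hta
    have hloga : 0 ≤ 1 - Real.log a := by linarith [Real.log_nonpos ha0.le ha1]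
    refine le_of_pow_le_pow_left₀ (n := d) (by omega) (by positivity) ?_
    -- Here `d ≥ 3` enters: two of the factors `a` form `(v * r ^ d * a) ^ 2`, and the third remains
    -- to absorb the logarithm.
    have h1 : a ^ d * (r ^ d) ^ 2 * v ^ 2 ≤ s ^ (2 * d) * a := by
      have h2 : a ^ d ≤ a ^ 3 := pow_le_pow_of_le_one ha0.le ha1 hd
      calc a ^ d * (r ^ d) ^ 2 * v ^ 2 ≤ a ^ 3 * (r ^ d) ^ 2 * v ^ 2 := by gcongr
        _ = (v * r ^ d * a) ^ 2 * a := by ring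
        _ = _ := by rw [hra, ← pow_mul, mul_comm 2 d]
    have h3 := one_sub_log_pow_mul_le d (by omega) ha0 ha1
    have h4 : 0 ≤ (1 - Real.log a) ^ d := pow_nonneg hloga d
    have h5 : 1 / v ^ 2 ≤ max 1 (1 / v ^ 2) ^ d :=
      (le_max_right _ _).trans (le_self_pow₀ (le_max_left _ _) (by omega))
    calc (a * (r ^ 2 * (1 - Real.log a))) ^ d
        = (a ^ d * (r ^ d) ^ 2 * v ^ 2) * (1 - Real.log a) ^ d * (1 / v ^ 2) := by
          rw [mul_pow, mul_pow]; field_simp; ring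
      _ ≤ (s ^ (2 * d) * a) * (1 - Real.log a) ^ d * (1 / v ^ 2) := by gcongr
      _ = s ^ (2 * d) * ((1 - Real.log a) ^ d * a) * (1 / v ^ 2) := by ring
      _ ≤ s ^ (2 * d) * d ^ d * max 1 (1 / v ^ 2) ^ d := by gcongr
      _ = (d * max 1 (1 / v ^ 2) * s ^ 2) ^ d := by rw [mul_pow, mul_pow, ← pow_mul]; ring
      _ ≤ _ := by gcongr

lemma exists_threshold {d : ℕ} (hd : 1 ≤ d) {v β : ℝ} (hv : 0 < v) (hβ : 0 < β) :
    ∃ M : ℝ, 1 ≤ M ∧ ∃ C : ℝ, 0 < C ∧ ∀ N k : ℕ, 2 ≤ k → k ≤ N →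
      (1 : ℝ) / N ≤ M * biasRate d N k ∧
      (M * biasRate d N k ≤ 1 → GoodThreshold d N k v β C (M * biasRate d N k)) := by
  unfold biasRate
  split_ifs with h
  · exact exists_threshold_of_two_lt h hv hβ
  · exact exists_threshold_of_le_two hd (by omega) hv hβ

end Rates

end

/-! ### Nets, union bounds, and the two density regions -/

section

variable {d : ℕ} {Cb Cc N₀ γ r₀ : ℝ} {f : EuclideanSpace ℝ (Fin d) → ℝ}

/-- Covering balls may have centres outside the level set; doubling the radius allows centres inside
it, where `f` is bounded below. -/
lemma LevelSetCovering.exists_net (h : LevelSetCovering N₀ γ r₀ f) (hN₀ : 0 ≤ N₀) {m r : ℝ}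
    (hm : 0 < m) (hr : 0 < r) (hr₀ : r ≤ r₀) :
    ∃ F : Finset (EuclideanSpace ℝ (Fin d)), (∀ z ∈ F, m < f z) ∧
      (∀ x, m < f x → ∃ z ∈ F, dist x z ≤ 2 * r) ∧ (F.card : ℝ) ≤ N₀ / (m ^ γ * r ^ d) := by
  lift r to ℝ≥0 using hr.le
  have hcov := h m hm r (by exact_mod_cast hr) hr₀
  have hle := Metric.coveringNumber_two_mul_le_externalCoveringNumber r {x | m < f x}
  have hcov' : (Metric.coveringNumber (2 * r) {x | m < f x} : ℝ≥0∞)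
      ≤ ENNReal.ofReal (N₀ / (m ^ γ * (r : ℝ) ^ d)) :=
    (ENat.toENNReal_le.2 hle).trans hcov
  have hne : Metric.coveringNumber (2 * r) {x | m < f x} ≠ ⊤ := by
    intro htop
    rw [htop, ENat.toENNReal_top, top_le_iff] at hcov'
    exact ENNReal.ofReal_ne_top hcov'
  obtain ⟨S, hS, hfin, hcover, hcard⟩ := Metric.exists_set_encard_eq_coveringNumber hne
  refine ⟨hfin.toFinset, fun z hz => hS (hfin.mem_toFinset.1 hz), fun x hx => ?_, ?_⟩
  · obtain ⟨z, hz, hxz⟩ := Set.mem_iUnion₂.1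
      (Metric.isCover_iff_subset_iUnion_closedBall.1 hcover hx)
    exact ⟨z, hfin.mem_toFinset.2 hz, by simpa using hxz⟩
  · rw [← hcard, hfin.encard_eq_coe_toFinset_card, ENat.toENNReal_coe,
      ← ENNReal.ofReal_natCast] at hcov'
    refine (ENNReal.ofReal_le_ofReal_iff ?_).1 hcov'
    have := Real.rpow_nonneg hm.le γ
    positivity

lemma LevelSetCovering.mono {N₁ : ℝ} (h : LevelSetCovering N₀ γ r₀ f) (h01 : N₀ ≤ N₁) :
    LevelSetCovering N₁ γ r₀ f := fun m hm r hr hr₀ =>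
  (h m hm r hr hr₀).trans (ENNReal.ofReal_le_ofReal
    (div_le_div_of_nonneg_right h01
      (mul_nonneg (Real.rpow_nonneg hm.le γ) (pow_nonneg r.2 d))))

lemma exists_pos_of_map_eq_withDensity {Ω : Type*} [MeasurableSpace Ω] {μ : Measure Ω}
    [IsProbabilityMeasure μ] {Y : Ω → EuclideanSpace ℝ (Fin d)} (hY : Measurable Y)
    (hlaw : μ.map Y = volume.withDensity (fun x => ENNReal.ofReal (f x))) : ∃ x, 0 < f x := by
  by_contra! hf
  have h0 : (fun x => ENNReal.ofReal (f x)) = 0 := by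
    ext x
    simp [ENNReal.ofReal_eq_zero.2 (hf x)]
  have := Measure.isProbabilityMeasure_map (μ := μ) hY.aemeasurable
  rw [h0, withDensity_zero] at hlaw
  exact IsProbabilityMeasure.ne_zero _ hlaw

/-- Monotonicity of the outer measure: no measurability of the uncountable supremum or of `S` is
needed. -/
lemma measure_not_supError_le {N k : ℕ} {Ω : Type*} [MeasurableSpace Ω] {μ : Measure Ω}
    {X : Fin N → Ω → EuclideanSpace ℝ (Fin d)} {c : ℝ} {S : Set Ω}
    (h : ∀ ω ∉ S, ∀ x, |estimator k (fun i => X i ω) x - f x| ≤ c) :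
    μ {ω | ¬ supError k (fun i => X i ω) f ≤ ENNReal.ofReal c} ≤ μ S := by
  refine measure_mono fun ω hω => ?_
  by_contra hS
  exact hω (iSup_le fun x => ENNReal.ofReal_le_ofReal (h ω hS x))

/-- Since `k - 1 ≥ k / 2`, the exponent `4 * A * (k - 1)` is at least `2 * log (N / ε)`: one copy
pays for the `N` sample points, the other for the factor `1 / 2`. -/
lemma nat_mul_exp_le_half {N k : ℕ} {A ε : ℝ} (hA : 0 ≤ A) (hk : 2 ≤ k) (hkN : k ≤ N)
    (hε : 0 < ε) (hε1 : ε < 1) (hL : Real.log (N / ε) ≤ A * k) :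
    N * Real.exp (-((k : ℝ) - 1) * (Real.log (Real.exp (1 + 4 * A)) - 1)) ≤ ε / 2 := by
  have hk' : (2 : ℝ) ≤ k := by exact_mod_cast hk
  have hN' : (2 : ℝ) ≤ N := hk'.trans (by exact_mod_cast hkN)
  have hN0 : (0 : ℝ) < N := by linarith
  rw [Real.log_exp]
  have h1 : -((k : ℝ) - 1) * (1 + 4 * A - 1) ≤ -Real.log (N / ε) + -Real.log (N / ε) := by
    nlinarith
  calc N * Real.exp (-((k : ℝ) - 1) * (1 + 4 * A - 1))
      ≤ N * Real.exp (-Real.log (N / ε) + -Real.log (N / ε)) := by gcongr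
    _ = ε * (ε / N) := by
      rw [Real.exp_add, Real.exp_neg, Real.exp_log (div_pos hN0 hε)]
      field_simp
    _ ≤ ε * (1 / 2) := by
      gcongr
    _ = ε / 2 := by ring

/-- The failure probabilities at the points of a polynomially large net add up to at most
`ε / 2`. -/
lemma card_mul_exp_le_half {N : ℕ} (hN : 2 ≤ N) {c γ m r ε Q C : ℝ} (hC : 1 ≤ C) (hγ : 0 ≤ γ)
    (hr : 0 < r) (hm : 1 / (N : ℝ) ≤ m) (hrC : N₀ / r ^ d = C) (hN₀ : 0 < N₀)
    (hc : c ≤ N₀ / (m ^ γ * (r / N ^ 2) ^ d)) (hε : 0 < ε) (hε1 : ε < 1)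
    (hQ : Q = γ + 2 * d + 2 * Real.log (4 * C) + 1) :
    c * (2 * Real.exp (-(Q * Real.log (N / ε)))) ≤ ε / 2 := by
  have hN0 : (0 : ℝ) < N := by positivity
  have hl := half_lt_log hN
  set l := Real.log N with hldef
  have hm0 : 0 < m := lt_of_lt_of_le (by positivity) hm
  have hlog4 : 0 ≤ Real.log (4 * C) := Real.log_nonneg (by linarith)
  have hcard : c ≤ C * Real.exp ((γ + 2 * d) * l) := by
    refine hc.trans ?_
    have h1 : Real.exp (-(γ * l)) ≤ m ^ γ := by
      rw [Real.rpow_def_of_pos hm0, Real.exp_le_exp]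
      have := Real.log_le_log (by positivity) hm
      rw [one_div, Real.log_inv] at this
      nlinarith
    have h2 : (r / (N : ℝ) ^ 2) ^ d = r ^ d * Real.exp (-(2 * d * l)) := by
      rw [div_pow, ← pow_mul, Real.exp_neg, div_eq_mul_inv, ← Real.exp_log (pow_pos hN0 (2 * d)),
        Real.log_pow]
      push_cast
      rfl
    rw [h2]
    calc N₀ / (m ^ γ * (r ^ d * Real.exp (-(2 * d * l))))
        ≤ N₀ / (Real.exp (-(γ * l)) * (r ^ d * Real.exp (-(2 * d * l)))) := by gcongr
      _ = C * Real.exp ((γ + 2 * d) * l) := by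
        rw [← hrC, Real.exp_neg, Real.exp_neg, add_mul, Real.exp_add]
        field_simp
  have hlε := Real.log_nonpos hε.le hε1.le
  -- In `Q`, `γ + 2 * d` pays for the net size, `2 * log (4 * C)` for the constant (as `log (N / ε)
  -- ≥ 1 / 2`), and `1` for `ε`.
  have hQL : (γ + 2 * d) * l + Real.log (4 * C) - Real.log ε ≤ Q * Real.log (N / ε) := by
    rw [Real.log_div hN0.ne' hε.ne', hQ, ← hldef]
    have e1 : (γ + 2 * d) * l ≤ (γ + 2 * d) * (l - Real.log ε) := by gcongr; linarith
    have e2 : 2 * Real.log (4 * C) * (1 / 2) ≤ 2 * Real.log (4 * C) * (l - Real.log ε) := by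
      gcongr; linarith
    nlinarith
  calc c * (2 * Real.exp (-(Q * Real.log (N / ε))))
      ≤ C * Real.exp ((γ + 2 * d) * l) * (2 * Real.exp
        (-((γ + 2 * d) * l + Real.log (4 * C) - Real.log ε))) := by gcongr
    _ = ε / 2 := by
      rw [neg_sub, Real.exp_sub, Real.exp_add, Real.exp_log hε, Real.exp_log (by positivity)]
      field_simp
      norm_num

lemma one_div_sq_le_two_mul_div {a L : ℝ} (ha : 1 ≤ a) (hL : 1 / 2 ≤ L) :
    (1 / a) ^ 2 ≤ 2 * (L / a) := by
  rw [div_pow, one_pow, ← mul_div_assoc, div_le_div_iff₀ (by positivity) (by linarith)]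
  nlinarith

section Regions

variable {N k : ℕ} {Ω : Type*} [MeasurableSpace Ω] {μ : Measure Ω} [IsProbabilityMeasure μ]
  {X : Fin N → Ω → EuclideanSpace ℝ (Fin d)} {A ε : ℝ}

/-- With high probability the estimator is bounded. -/
lemma measure_exists_lt_estimator_le_half (hd : 1 ≤ d) (hX : ∀ i, Measurable (X i))
    (hind : iIndepFun X μ)
    (hlaw : ∀ i, μ.map (X i) = volume.withDensity (fun x => ENNReal.ofReal (f x)))
    (hf : SmoothTail Cb Cc f) (hA : 0 ≤ A) (hk : 2 ≤ k) (hkN : k ≤ N)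
    (hε : 0 < ε) (hε1 : ε < 1) (hL : Real.log (N / ε) ≤ A * k) :
    μ {ω | ∃ x, 2 ^ d * Real.exp (1 + 4 * A) < estimator k (fun i => X i ω) x}
      ≤ ENNReal.ofReal (ε / 2) := by
  have hk' : (2 : ℝ) ≤ k := by exact_mod_cast hk
  have hN' : (2 : ℝ) ≤ N := hk'.trans (by exact_mod_cast hkN)
  have hN0 : (0 : ℝ) < N := by linarith
  obtain ⟨r, hr, hrk⟩ := exists_pow_mul_eq hd (unitBall_pos d)
    (show 0 < ((k : ℝ) - 1) / (N * (2 ^ d * (Real.exp (1 + 4 * A) * 1))) from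
      div_pos (by linarith) (by positivity))
  have h := measure_exists_lt_estimator_le (D := Set.univ) (s := 1) (r := r)
    (K := Real.exp (1 + 4 * A)) hX hind hlaw hf.nonneg hf.differentiable.continuous
    (by omega) hkN (Real.one_le_exp (by linarith)) hr (fun x _ y _ => hf.le_one y)
    (by rw [hrk]; field_simp)
  simp only [Set.mem_univ, true_and, mul_one] at h
  exact h.trans (ENNReal.ofReal_le_ofReal (nat_mul_exp_le_half hA hk hkN hε hε1 hL))

/-- With high probability the estimator is small where the density is. -/
lemma measure_exists_le_lt_estimator_le_half (hd : 1 ≤ d) (hX : ∀ i, Measurable (X i))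
    (hind : iIndepFun X μ)
    (hlaw : ∀ i, μ.map (X i) = volume.withDensity (fun x => ENNReal.ofReal (f x)))
    (hf : SmoothTail Cb Cc f) (hpos : ∀ x, 0 < f x) (hCb : 0 ≤ Cb) (hA : 0 ≤ A) (hk : 2 ≤ k)
    (hkN : k ≤ N) (hε : 0 < ε) (hε1 : ε < 1) (hL : Real.log (N / ε) ≤ A * k)
    {β C t : ℝ} (ht0 : 0 < t) (ht1 : t ≤ 1) (hβ : 3 * Cb * β ≤ 1)
    (ht : GoodThreshold d N k
      (volume.real (Metric.ball (0 : EuclideanSpace ℝ (Fin d)) 1)) β C t) :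
    μ {ω | ∃ x, f x ≤ t ∧ 2 ^ d * (Real.exp (1 + 4 * A) * (Real.exp 1 * t))
      < estimator k (fun i => X i ω) x} ≤ ENNReal.ofReal (ε / 2) := by
  have hk' : (2 : ℝ) ≤ k := by exact_mod_cast hk
  have hN' : (2 : ℝ) ≤ N := hk'.trans (by exact_mod_cast hkN)
  have hN0 : (0 : ℝ) < N := by linarith
  have hK : 1 ≤ Real.exp (1 + 4 * A) := Real.one_le_exp (by linarith)
  obtain ⟨r, hr, hrk⟩ := exists_pow_mul_eq hd (unitBall_pos d)
    (show 0 < ((k : ℝ) - 1) / (N * (2 ^ d * (Real.exp (1 + 4 * A) * (Real.exp 1 * t)))) from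
      div_pos (by linarith) (by positivity))
  -- The constants in the definition of `r` are at least `1`, so `v * r ^ d * t ≤ k / N`.
  have hrβ : r * (1 - Real.log t) ≤ β := by
    refine ht.radius_le r hr.le ?_
    rw [hrk, div_mul_eq_mul_div, div_le_div_iff₀ (by positivity) hN0]
    have h1 : 1 ≤ 2 ^ d * (Real.exp (1 + 4 * A) * Real.exp 1) :=
      one_le_mul_of_one_le_of_one_le (one_le_pow₀ (by norm_num))
        (one_le_mul_of_one_le_of_one_le hK (Real.one_le_exp zero_le_one))
    calc ((k : ℝ) - 1) * t * N ≤ k * t * N * 1 := by rw [mul_one]; gcongr; linarith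
      _ ≤ k * t * N * (2 ^ d * (Real.exp (1 + 4 * A) * Real.exp 1)) := by gcongr
      _ = _ := by ring
  refine (measure_exists_lt_estimator_le (D := {x | f x ≤ t}) (s := Real.exp 1 * t) (r := r)
    (K := Real.exp (1 + 4 * A)) hX hind hlaw hf.nonneg hf.differentiable.continuous
    (by omega) hkN hK hr (fun x hx y hy => ?_)
    (by rw [hrk]; field_simp)).trans
    (ENNReal.ofReal_le_ofReal (nat_mul_exp_le_half hA hk hkN hε hε1 hL))
  refine hf.le_exp_one_mul hpos hCb ht0 ht1 hx ?_
  have hlog : 0 ≤ 1 - Real.log t := by linarith [Real.log_nonpos ht0.le ht1]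
  have hxy : dist x y ≤ 3 * r := by rw [dist_comm]; exact hy
  calc Cb * dist x y * (1 - Real.log t) ≤ Cb * (3 * r) * (1 - Real.log t) := by gcongr
    _ = 3 * Cb * (r * (1 - Real.log t)) := by ring
    _ ≤ 3 * Cb * β := by gcongr
    _ ≤ 1 := hβ

set_option maxHeartbeats 400000 in
/-- With high probability the estimator is accurate where the density is not small. -/
lemma measure_exists_lt_and_lt_abs_sub_le_half (hd : 1 ≤ d) (hX : ∀ i, Measurable (X i))
    (hind : iIndepFun X μ)
    (hlaw : ∀ i, μ.map (X i) = volume.withDensity (fun x => ENNReal.ofReal (f x)))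
    (hf : SmoothTail Cb Cc f) (hpos : ∀ x, 0 < f x) (hCb : 0 ≤ Cb) (hCc : 0 ≤ Cc)
    (hcov : LevelSetCovering N₀ γ r₀ f) (hγ : 0 ≤ γ) (hN₀ : 0 < N₀) (hk : 2 ≤ k)
    (hkN : k ≤ N) (hε : 0 < ε) (hε1 : ε < 1)
    {β C t c₁ C₄ Q η : ℝ} (ht0 : 1 / (N : ℝ) ≤ t) (hβ1 : β ≤ 1)
    (hβb : 3 * Cb * β ≤ 1) (hβc : 16 * (Cc * Real.exp 2) * β ≤ 1 / 8)
    (ht : GoodThreshold d N k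
      (volume.real (Metric.ball (0 : EuclideanSpace ℝ (Fin d)) 1)) β C t)
    (hc₁ : 0 < c₁) (hc₁r : c₁ ≤ r₀)
    (hc₁v : c₁ * (4 * max 1 (volume.real (Metric.ball (0 : EuclideanSpace ℝ (Fin d)) 1))) ≤ 1)
    (hC₄ : N₀ / c₁ ^ d = C₄) (hC₄1 : 1 ≤ C₄)
    (hQ : Q = γ + 2 * d + 2 * Real.log (4 * C₄) + 1) (hη0 : 0 ≤ η)
    (hη : η ^ 2 = 32 * Q * (Real.log (N / ε) / k)) (hη8 : η ≤ 1 / 8) :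
    μ {ω | ∃ x, t < f x ∧ Cb * (1 / k) + 2 ^ d / k
        + d * 2 ^ d * (4 * (η + 16 * (Cc * Real.exp 2) * (C * t)))
      < |estimator k (fun i => X i ω) x - f x|} ≤ ENNReal.ofReal (ε / 2) := by
  have hk' : (2 : ℝ) ≤ k := by exact_mod_cast hk
  have hk0 : (0 : ℝ) < k := by linarith
  have hkN' : (k : ℝ) ≤ N := by exact_mod_cast hkN
  have hN' : (2 : ℝ) ≤ N := hk'.trans hkN'
  have hN0 : (0 : ℝ) < N := by linarith
  have hN2 : 2 ≤ N := hk.trans hkN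
  have ht0' : 0 < t := lt_of_lt_of_le (by positivity) ht0
  have hv := unitBall_pos d
  set v := volume.real (Metric.ball (0 : EuclideanSpace ℝ (Fin d)) 1) with hvdef
  set w := max 1 v with hw
  have hw1 : 1 ≤ w := le_max_left _ _
  have hvw : v ≤ w := le_max_right _ _
  have hc₁1 : c₁ ≤ 1 / 4 := by nlinarith
  have hδN : c₁ / (N : ℝ) ^ 2 ≤ c₁ := div_le_self hc₁.le (one_le_pow₀ (by linarith))
  obtain ⟨F, hFt, hFcover, hFcard⟩ := hcov.exists_net hN₀.le ht0'
    (show 0 < c₁ / (N : ℝ) ^ 2 by positivity) (hδN.trans hc₁r)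
  have hex : ∀ z, ∃ R : ℝ, 0 < R ∧ v * R ^ d = (k : ℝ) / N / f z := fun z =>
    exists_pow_mul_eq hd hv (div_pos (by positivity) (hpos z))
  choose R hR0 hR using hex
  have hRk : ∀ z, v * R z ^ d * f z = (k : ℝ) / N := fun z => by
    rw [hR]
    have := (hpos z).ne'
    field_simp
  have hlog : ∀ z, 1 ≤ 1 - Real.log (f z) := fun z => by
    linarith [Real.log_nonpos (hpos z).le (hf.le_one z)]
  have hRβ : ∀ z, t < f z → R z * (1 - Real.log (f z)) ≤ β := fun z hz => by
    refine le_trans (mul_le_mul_of_nonneg_left ?_ (hR0 z).le) (ht.radius_le _ (hR0 z).le ?_)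
    · linarith [Real.log_le_log ht0' hz.le]
    · rw [← hRk z]
      have := hR0 z
      gcongr
  have hRβ' : ∀ z, t < f z → R z ≤ β := fun z hz =>
    (le_mul_of_one_le_right (hR0 z).le (hlog z)).trans (hRβ z hz)
  -- Because `f ≤ 1`, `R` is at least of order `1 / N`. As also `η ≥ 1 / N`, a net at scale `1 / N ^
  -- 2` is fine enough.
  have hRlow : ∀ z, 1 / (N * w) ≤ R z := fun z => by
    have h1 : 1 / (N : ℝ) ≤ w * R z ^ d := by
      calc 1 / (N : ℝ) ≤ (k : ℝ) / N := by gcongr; linarith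
        _ = v * R z ^ d * f z := (hRk z).symm
        _ ≤ v * R z ^ d * 1 := by
          have := hR0 z
          gcongr
          exact hf.le_one z
        _ ≤ w * R z ^ d := by
          have := hR0 z
          rw [mul_one]; gcongr
    rcases le_total 1 (R z) with h | h
    · refine le_trans ?_ h
      rw [div_le_one (by positivity)]
      nlinarith
    · have h2 := pow_le_of_le_one (hR0 z).le h (show d ≠ 0 by omega)
      rw [div_le_iff₀ (by positivity)]
      have : 1 / (N : ℝ) ≤ w * R z := h1.trans (by gcongr)
      rw [div_le_iff₀ hN0] at this
      linarith
  have hL : 1 / 2 ≤ Real.log (N / ε) := by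
    rw [Real.log_div hN0.ne' hε.ne']
    linarith [half_lt_log hN2, Real.log_nonpos hε.le hε1.le]
  have hlog4 : 0 ≤ Real.log (4 * C₄) := Real.log_nonneg (by linarith)
  have hQ1 : 1 ≤ Q := by
    rw [hQ]
    have : (0 : ℝ) ≤ d := Nat.cast_nonneg d
    linarith
  have hηlow : 1 / (N : ℝ) ≤ η := by
    refine le_of_pow_le_pow_left₀ (n := 2) (by norm_num) hη0 ?_
    rw [hη]
    have e1 : 1 / (N : ℝ) ≤ 1 / k := one_div_le_one_div_of_le hk0 hkN'
    have e2 : 0 ≤ Real.log (N / ε) / k := div_nonneg (by linarith) hk0.le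
    have e3 := one_div_sq_le_two_mul_div (show (1 : ℝ) ≤ k by linarith) hL
    have e4 := pow_le_pow_left₀ (by positivity) e1 2
    nlinarith
  have hδη : ∀ z, 2 * (c₁ / (N : ℝ) ^ 2) ≤ η * R z := fun z => by
    calc 2 * (c₁ / (N : ℝ) ^ 2) ≤ 1 / N * (1 / (N * w)) := by
          rw [div_mul_div_comm, mul_one, ← mul_div_assoc, div_le_div_iff₀ (by positivity)
            (by positivity)]
          nlinarith [sq_nonneg (N : ℝ)]
      _ ≤ η * R z := by
        have := hRlow z
        gcongr
  have hδk : 2 * (c₁ / (N : ℝ) ^ 2) ≤ 1 / k := by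
    rw [← mul_div_assoc, div_le_div_iff₀ (by positivity) hk0]
    nlinarith
  have hmain := measure_exists_lt_abs_sub_le (D := {x | t < f x}) (F := F)
    (δ := 2 * (c₁ / (N : ℝ) ^ 2)) (η := η) (b := β) (B := C * t) hd hX hind hlaw hf hpos hCb hCc
    (by omega) hkN hFt hFcover (R := R) (fun z _ => hR0 z) (fun z _ => hRk z)
    (fun z hz => by
      have := mul_le_mul_of_nonneg_left (hRβ z hz) (show 0 ≤ 2 * Cb by linarith)
      linarith) hη0 hη8 hβc
    (fun z hz => by
      calc R z ^ 2 * (1 - Real.log (f z)) = R z * (R z * (1 - Real.log (f z))) := by ring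
        _ ≤ 1 * β := mul_le_mul ((hRβ' z hz).trans hβ1) (hRβ z hz)
          (mul_nonneg (hR0 z).le (by linarith [hlog z])) zero_le_one
        _ = β := one_mul β)
    (fun z hz => ht.bias_le _ _ (le_of_lt hz) (hf.le_one z) (hR0 z).le (hRk z))
    (fun z _ => hδη z)
  have hkη : k * η ^ 2 / 32 = Q * Real.log (N / ε) := by
    rw [hη]; field_simp
  rw [hkη] at hmain
  refine (measure_mono ?_).trans (hmain.trans (ENNReal.ofReal_le_ofReal
    (card_mul_exp_le_half hN2 hC₄1 hγ hc₁ ht0 hC₄ hN₀ hFcard hε hε1 hQ)))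
  rintro ω ⟨x, hx, hlt⟩
  exact ⟨x, hx, lt_of_le_of_lt (by gcongr) hlt⟩

end Regions

end

/-! ### Choice of constants and the final case distinction -/

section

set_option maxHeartbeats 800000 in
lemma exists_rate_constant (d : ℕ) (hd : 1 ≤ d) {Cb Cc N₀ γ r₀ A : ℝ} (hCb : 1 ≤ Cb)
    (hCc : 1 ≤ Cc) (hA : 0 ≤ A) (hγ : 0 ≤ γ) (hr₀ : 0 < r₀) :
    ∃ C : ℝ, 0 < C ∧
      ∀ (Ω : Type*) [MeasurableSpace Ω] (μ : Measure Ω) [IsProbabilityMeasure μ]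
        (f : EuclideanSpace ℝ (Fin d) → ℝ),
        SmoothTail Cb Cc f → LevelSetCovering N₀ γ r₀ f →
      ∀ (N k : ℕ) (X : Fin N → Ω → EuclideanSpace ℝ (Fin d)),
        2 ≤ k → k ≤ N →
        (∀ i, Measurable (X i)) → iIndepFun X μ →
        (∀ i, μ.map (X i) = volume.withDensity (fun x => ENNReal.ofReal (f x))) →
      ∀ ε : ℝ, 0 < ε → ε < 1 → Real.log (N / ε) ≤ A * k →
        μ {ω | ¬ supError k (fun i => X i ω) f ≤ ENNReal.ofReal (C * rate d N k ε)}
          ≤ ENNReal.ofReal ε := by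
  set v := volume.real (Metric.ball (0 : EuclideanSpace ℝ (Fin d)) 1) with hv
  -- Small enough for all smallness conditions at once: the radius, gradient and Hessian ones.
  set β : ℝ := 1 / (2000 * (Cb + Cc)) with hβ
  have hβ0 : 0 < β := by positivity
  have hβ1 : β ≤ 1 := by rw [hβ, div_le_one (by positivity)]; linarith
  have hβb : 3 * Cb * β ≤ 1 := by
    rw [hβ, mul_one_div, div_le_one (by positivity)]; linarith
  have hexp2 : Real.exp 2 ≤ 9 := by
    rw [show (2 : ℝ) = 1 + 1 by norm_num, Real.exp_add]
    nlinarith [Real.exp_one_lt_d9, Real.exp_pos 1]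
  have hβc : 16 * (Cc * Real.exp 2) * β ≤ 1 / 8 := by
    rw [hβ, mul_one_div, div_le_div_iff₀ (by positivity) (by norm_num)]
    nlinarith
  obtain ⟨M, hM1, C₃, hC₃, hthr⟩ := exists_threshold hd (unitBall_pos d) hβ0
  set w := 4 * max 1 v with hw
  have hw4 : 4 ≤ w := by linarith [le_max_left 1 v]
  have hw0 : 0 < w := by linarith
  -- enlarging the covering constant makes the number of net points at least one
  set c₁ := min r₀ (1 / w) with hc₁
  have hc₁0 : 0 < c₁ := lt_min hr₀ (by positivity)
  have hc₁r : c₁ ≤ r₀ := min_le_left _ _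
  have hc₁w : c₁ * w ≤ 1 := (le_div_iff₀ hw0).1 (min_le_right _ _)
  have hc₁1 : c₁ ≤ 1 := by nlinarith
  set N₁ := max N₀ 1 with hN₁
  have hN₁1 : 1 ≤ N₁ := le_max_right _ _
  set C₄ := N₁ / c₁ ^ d with hC₄
  have hC₄1 : 1 ≤ C₄ := by
    rw [hC₄, le_div_iff₀ (by positivity), one_mul]
    exact (pow_le_one₀ hc₁0.le hc₁1).trans hN₁1
  set Q := γ + 2 * d + 2 * Real.log (4 * C₄) + 1 with hQ
  have hQ0 : 0 ≤ Q := by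
    have : 0 ≤ Real.log (4 * C₄) := Real.log_nonneg (by linarith)
    positivity
  set S := √(32 * Q) with hS
  have hS0 : 0 ≤ S := Real.sqrt_nonneg _
  set T := 2 ^ d * Real.exp (1 + 4 * A) with hT
  have hT1 : 1 ≤ T := one_le_mul_of_one_le_of_one_le (one_le_pow₀ (by norm_num))
    (Real.one_le_exp (by linarith))
  set C₅ := d * 2 ^ d * (4 * S) with hC₅
  set C₆ := d * 2 ^ d * (4 * (16 * (Cc * Real.exp 2) * (C₃ * M))) with hC₆
  have hC₅0 : 0 ≤ C₅ := by positivity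
  have hC₆0 : 0 ≤ C₆ := by positivity
  have hTe : 0 ≤ T * Real.exp 1 * M := by positivity
  have hTM : 0 ≤ T * M := by positivity
  have hTS : 0 ≤ T * (8 * S) := by positivity
  have hb0 : (0 : ℝ) ≤ 2 * (Cb + 2 ^ d) := by positivity
  -- The sum of the coefficients from all regimes, so that each of them is at most `C`.
  set C := T * M + T * (8 * S) + T * Real.exp 1 * M + 2 * (Cb + 2 ^ d) + C₅ + C₆ with hC
  refine ⟨C, by
    have : 0 < T * M := by positivity
    linarith, fun Ω _ μ _ f hf hcov N k X hk hkN hX hind hlaw ε hε hε1 hL => ?_⟩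
  have hk' : (2 : ℝ) ≤ k := by exact_mod_cast hk
  have hk0 : (0 : ℝ) < k := by linarith
  have hN2 : 2 ≤ N := hk.trans hkN
  have hN0 : (0 : ℝ) < N := by positivity
  obtain ⟨htN, hgood⟩ := hthr N k hk hkN
  obtain ⟨x₀, hx₀⟩ := exists_pos_of_map_eq_withDensity (hX ⟨0, by omega⟩) (hlaw ⟨0, by omega⟩)
  have hpos := hf.pos (by linarith) hx₀
  have hLhalf : 1 / 2 ≤ Real.log (N / ε) := by
    rw [Real.log_div hN0.ne' hε.ne']
    linarith [half_lt_log hN2, Real.log_nonpos hε.le hε1.le]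
  rw [rate_eq]
  set b := biasRate d N k with hb
  set η₀ := √(Real.log (N / ε) / k) with hη₀
  have hη₀0 : 0 ≤ η₀ := Real.sqrt_nonneg _
  have hη₀sq : η₀ ^ 2 = Real.log (N / ε) / k := Real.sq_sqrt (div_nonneg (by linarith) hk0.le)
  have hb0' : 0 < b := by
    have : 0 < M * b := lt_of_lt_of_le (by positivity) htN
    exact pos_of_mul_pos_right this (by linarith)
  have hhalf : 0 ≤ ε / 2 := by linarith
  have herr : ∀ {x c : ℝ}, 0 ≤ x → ∀ {y : ℝ}, 0 ≤ y → x ≤ c → y ≤ c → |x - y| ≤ c :=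
    fun hx _ hy hxc hyc => abs_le.2 ⟨by linarith, by linarith⟩
  have hfirst : ∀ p q : ℝ, 0 ≤ p → p ≤ C → 0 ≤ q → q ≤ C → p * b + q * η₀ ≤ C * (b + η₀) :=
    fun p q _ hp _ hq => by
      rw [mul_add]
      exact add_le_add (mul_le_mul_of_nonneg_right hp hb0'.le)
        (mul_le_mul_of_nonneg_right hq hη₀0)
  -- Otherwise `M * b` or `8 * S * η₀` exceeds `1`, and the uniform bound `T` on the estimator is
  -- already at most `C` times the rate.
  by_cases hcase : M * b ≤ 1 ∧ S * η₀ ≤ 1 / 8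
  · obtain ⟨ht1, hη8⟩ := hcase
    have ht0 : 0 < M * b := by positivity
    have hlow := measure_exists_le_lt_estimator_le_half hd hX hind hlaw hf hpos (by linarith) hA
      hk hkN hε hε1 hL ht0 ht1 hβb (hgood ht1)
    have hhigh := measure_exists_lt_and_lt_abs_sub_le_half hd hX hind hlaw hf hpos
      (by linarith) (by linarith) (hcov.mono (le_max_left N₀ 1)) hγ (by linarith) hk hkN hε hε1
      htN hβ1 hβb hβc (hgood ht1) hc₁0 hc₁r hc₁w hC₄.symm hC₄1 hQ
      (mul_nonneg hS0 hη₀0)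
      (by rw [mul_pow, hS, Real.sq_sqrt (by positivity), hη₀sq]) hη8
    refine (measure_not_supError_le (fun ω hω x => ?_)).trans ((measure_union_le _ _).trans
      ((add_le_add hlow hhigh).trans_eq
        (by rw [← ENNReal.ofReal_add hhalf hhalf, add_halves])))
    simp only [Set.mem_union, Set.mem_ofPred_eq, not_or, not_exists, not_and, not_lt] at hω
    rcases le_or_gt (f x) (M * b) with hx | hx
    · refine le_trans ?_ (hfirst (T * Real.exp 1 * M) 0 hTe (by linarith) le_rfl (by linarith))
      refine herr (estimator_nonneg (by omega)) (hf.nonneg x)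
        ((hω.1 x hx).trans_eq (by rw [hT]; ring)) (hx.trans ?_)
      have h1 : 1 ≤ T * Real.exp 1 :=
        one_le_mul_of_one_le_of_one_le hT1 (Real.one_le_exp zero_le_one)
      nlinarith
    · refine (hω.2 x hx).trans (le_trans ?_ (hfirst C₆ (2 * (Cb + 2 ^ d) + C₅) hC₆0 (by linarith)
        (by linarith) (by linarith)))
      -- Absorbs the errors of order `1 / k`, from the net and from `k - 1`, into the stochastic
      -- term.
      have hkη : 1 / (k : ℝ) ≤ 2 * η₀ := by
        refine le_of_pow_le_pow_left₀ (n := 2) (by norm_num) (by positivity) ?_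
        rw [mul_pow, hη₀sq]
        have := one_div_sq_le_two_mul_div (show (1 : ℝ) ≤ k by linarith) hLhalf
        have := div_nonneg (show 0 ≤ Real.log (N / ε) by linarith) hk0.le
        linarith
      calc Cb * (1 / k) + 2 ^ d / k + d * 2 ^ d * (4 * (S * η₀ + 16 * (Cc * Real.exp 2)
            * (C₃ * (M * b))))
          = (Cb + 2 ^ d) * (1 / k) + (C₅ * η₀ + C₆ * b) := by rw [hC₅, hC₆]; ring
        _ ≤ (Cb + 2 ^ d) * (2 * η₀) + (C₅ * η₀ + C₆ * b) := by gcongr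
        _ = C₆ * b + (2 * (Cb + 2 ^ d) + C₅) * η₀ := by ring
  · have hbdd := measure_exists_lt_estimator_le_half hd hX hind hlaw hf hA hk hkN hε hε1 hL
    refine (measure_not_supError_le (fun ω hω x => ?_)).trans
      (hbdd.trans (ENNReal.ofReal_le_ofReal (by linarith)))
    simp only [Set.mem_ofPred_eq, not_exists, not_lt] at hω
    have hTC : T ≤ C * (b + η₀) := by
      refine le_trans ?_ (hfirst (T * M) (T * (8 * S)) hTM (by linarith) hTS (by linarith))
      have e1 : 0 ≤ T * M * b := by positivity
      have e2 : 0 ≤ T * (8 * S) * η₀ := by positivity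
      rw [not_and_or, not_le, not_le] at hcase
      rcases hcase with h | h
      · nlinarith
      · nlinarith
    exact herr (estimator_nonneg (by omega)) (hf.nonneg x) ((hω x).trans hTC)
      ((hf.le_one x).trans (hT1.trans hTC))

end

end KNN

theorem theorem5 (d : ℕ) (hd : 1 ≤ d) (Cb Cc N₀ γ r₀ A : ℝ) (hγ : 0 < γ) (hr₀ : 0 < r₀) :
    ∃ C : ℝ, 0 < C ∧
      ∀ (Ω : Type*) [MeasurableSpace Ω] (μ : Measure Ω) [IsProbabilityMeasure μ]
        (f : EuclideanSpace ℝ (Fin d) → ℝ),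
        KNN.SmoothTail Cb Cc f → KNN.LevelSetCovering N₀ γ r₀ f →
      ∀ (N k : ℕ) (X : Fin N → Ω → EuclideanSpace ℝ (Fin d)),
        2 ≤ k → k ≤ N →
        (∀ i, Measurable (X i)) → iIndepFun X μ →
        (∀ i, μ.map (X i) = volume.withDensity (fun x => ENNReal.ofReal (f x))) →
      ∀ ε : ℝ, 0 < ε → ε < 1 → Real.log (N / ε) ≤ A * k →
        -- with probability at least `1 - ε`, the supremum is at most `C` times the rate
        μ {ω | ¬ KNN.supError k (fun i => X i ω) f ≤ ENNReal.ofReal (C * KNN.rate d N k ε)}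
          ≤ ENNReal.ofReal ε := by
  -- The given constants may have any sign; enlarging them only weakens the hypotheses.
  obtain ⟨C, hC, h⟩ := KNN.exists_rate_constant d hd (Cb := max Cb 1) (Cc := max Cc 1)
    (N₀ := N₀) (A := max A 0) (le_max_right _ _) (le_max_right _ _) (le_max_right _ _) hγ.le hr₀
  refine ⟨C, hC, fun Ω _ μ _ f hf hcov N k X hk hkN hX hind hlaw ε hε hε1 hL => ?_⟩
  exact h Ω μ f (hf.mono (le_max_left _ _) (le_max_left _ _)) hcov N k X hk hkN hX hind hlaw ε hε hε1
    (hL.trans (mul_le_mul_of_nonneg_right (le_max_left _ _) (Nat.cast_nonneg k)))
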